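/- Let $\Omega\subset\mathbb{R}^n$, $n\ge 1$, be a bounded open set with boundary of class $C^1$, let $a_{ij}=a_{ji}\in C^1(\overline\Omega)$ satisfy, for some $c_0>0$, $\sum_{i,j}a_{ij}(x)\xi_i\xi_j\ge c_0|\xi|^2$ for all $x\in\Omega$, $\xi\in\mathbb{R}^n$, and let $2\le p<\infty$, $\alpha\in(0,1)$, $\lambda\in\mathbb{R}$. Consider on $X=L^p(\Omega)$ (real valued) the operator $A_p u=-\sum_{i,j}D_j(a_{ij}D_iu)$ with domain $D(A_p)=W^{2,p}(\Omega)\cap W^{1,p}_0(\Omega)$. Let $S(t)$ be the semigroup generated by $-A_p$, let $$A_p^{-\alpha}=\frac1{\Gamma(\alpha)}\int_0^\infty t^{\alpha-1}S(t)\,dt$$ (integral in the space of bounded operators on $X$), and let $X^\alpha=D(A_p^\alpha)$ be the range of $A_p^{-\alpha}$, with the norm $\|u\|_\alpha=\|A_p^\alpha u\|_{L^p}$. (Should $-A_p$ fail to generate a $C_0$-semigroup or the integral fail to converge absolutely, $A_p^{-\alpha}$ is read as $0$, so $X^\alpha=\{0\}$.) Put $X_0=\ker(\lambda I-A_p)$,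 let $X_-$ be the sum of the spaces $\ker(\mu I-A_p)$, $\mu<\lambda$, let $X_+$ be the set of $u\in X$ that are orthogonal in $L^2(\Omega)$ to $X_0$ and $X_-$, and put $X^\alpha_\pm=X^\alpha\cap X_\pm$. Let $f:\Omega\times\mathbb{R}\to\mathbb{R}$ be continuous, with constants $L,m>0$ such that $|f(x,s_1)-f(x,s_2)|\le L|s_1-s_2|$ and $|f(x,s)|\le m$ for all $x\in\Omega$, $s,s_1,s_2\in\mathbb{R}$, and let $F(u)(x)=f(x,u(x))$. Let $f_+,f_-:\Omega\to\mathbb{R}$ be continuous functions with $f_\pm(x)=\lim_{s\to\pm\infty}f(x,s)$ for $x\in\Omega$. (i) Assume $$\int_{\{u>0\}}f_+(x)u(x)\,dx+\int_{\{u<0\}}f_-(x)u(x)\,dx>0\quad\text{for all }u\in X_0\setminus\{0\}.\tag{LL1}$$ If $B_1\subset X^\alpha_+\oplus X^\alpha_-$ and $B_2\subset X_0$ are bounded in the norms $\|\cdot\|_\alpha$ and $\|\cdot\|_{L^2}$, respectively, then there are constants $R,\rho>0$ such that $$\langle F(z+x),x\rangle_{L^2}>-\langle F(z+x),y\rangle_{L^2}+\rho$$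 for all $(z,y,x)\in B_1\times B_2\times X_0$ with $\|x\|_{L^2}\ge R$. (ii) Assume $$\int_{\{u>0\}}f_+(x)u(x)\,dx+\int_{\{u<0\}}f_-(x)u(x)\,dx<0\quad\text{for all }u\in X_0\setminus\{0\}.\tag{LL2}$$ If $B_1\subset X^\alpha_+\oplus X^\alpha_-$ and $B_2\subset X_0$ are bounded in the norms $\|\cdot\|_\alpha$ and $\|\cdot\|_{L^2}$, respectively, then there are constants $R,\rho>0$ such that $$\langle F(z+x),x\rangle_{L^2}<-\langle F(z+x),y\rangle_{L^2}-\rho$$ for all $(z,y,x)\in B_1\times B_2\times X_0$ with $\|x\|_{L^2}\ge R$. -/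

import Mathlib

open MeasureTheory Set Filter Topology
open scoped ENNReal ContDiff

noncomputable section

namespace LL

/-! ### Domains, coefficients and test functions -/

/-- Euclidean space `ℝⁿ`. -/
abbrev E (n : ℕ) : Type := EuclideanSpace ℝ (Fin n)

/-- The boundary of `Ω` is of class `C¹`: near each boundary point, `Ω` is the region where a `C¹`
function with nonvanishing gradient is negative (by the implicit function theorem: the region on
one side of the graph of a `C¹` function). -/
def HasC1Boundary {n : ℕ} (Ω : Set (E n)) : Prop :=
  ∀ x₀ ∈ frontier Ω, ∃ U : Set (E n), IsOpen U ∧ x₀ ∈ U ∧ ∃ r : E n → ℝ,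
    ContDiffOn ℝ 1 r U ∧ fderiv ℝ r x₀ ≠ 0 ∧ ∀ x ∈ U, (x ∈ Ω ↔ r x < 0)

/-- The classical partial derivative `D_i g`. -/
def partialDeriv {n : ℕ} (i : Fin n) (g : E n → ℝ) (x : E n) : ℝ :=
  fderiv ℝ g x (EuclideanSpace.single i 1)

/-- `g ∈ C¹(closure Ω)`: `g` is of class `C¹` in `Ω`, and `g` and its gradient extend continuously
to the closure of `Ω`. -/
def IsC1Closure {n : ℕ} (Ω : Set (E n)) (g : E n → ℝ) : Prop :=
  ContDiffOn ℝ 1 g Ω ∧ ContinuousOn g (closure Ω) ∧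
    ∃ G : E n → (E n →L[ℝ] ℝ), ContinuousOn G (closure Ω) ∧ EqOn G (fderiv ℝ g) Ω

/-- The coefficients `a_ij ∈ C¹(closure Ω)` are symmetric and uniformly elliptic. -/
structure IsEllipticCoeff {n : ℕ} (Ω : Set (E n)) (a : Fin n → Fin n → E n → ℝ) : Prop where
  smooth : ∀ i j, IsC1Closure Ω (a i j)
  symm : ∀ i j, ∀ x ∈ Ω, a i j x = a j i x
  elliptic : ∃ c₀ : ℝ, 0 < c₀ ∧
    ∀ x ∈ Ω, ∀ ξ : E n, c₀ * ‖ξ‖ ^ 2 ≤ ∑ i, ∑ j, a i j x * ξ i * ξ j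

/-- Test functions: elements of `C_c^∞(Ω)`, extended by zero. -/
def IsTest {n : ℕ} (Ω : Set (E n)) (φ : E n → ℝ) : Prop :=
  ContDiff ℝ ∞ φ ∧ HasCompactSupport φ ∧ tsupport φ ⊆ Ω

/-- `v` is the weak partial derivative `D_i u` in `Ω`. -/
def IsWeakPartial {n : ℕ} (Ω : Set (E n)) (i : Fin n) (u v : E n → ℝ) : Prop :=
  ∀ φ : E n → ℝ, IsTest Ω φ →
    ∫ x in Ω, u x * partialDeriv i φ x = - ∫ x in Ω, v x * φ x

theorem isFiniteMeasure_of_bounded {n : ℕ} {Ω : Set (E n)} (hb : Bornology.IsBounded Ω) :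
    IsFiniteMeasure (volume.restrict Ω) :=
  isFiniteMeasure_restrict.2 hb.measure_lt_top.ne

theorem partialDeriv_continuous {n : ℕ} {φ : E n → ℝ} (h : ContDiff ℝ 1 φ) (i : Fin n) :
    Continuous (partialDeriv i φ) :=
  (h.continuous_fderiv (by simp)).clm_apply continuous_const

theorem partialDeriv_hasCompactSupport {n : ℕ} {φ : E n → ℝ} (h : HasCompactSupport φ)
    (i : Fin n) : HasCompactSupport (partialDeriv i φ) :=
  (h.fderiv ℝ).comp_left (g := fun L : E n →L[ℝ] ℝ => L (EuclideanSpace.single i 1)) (by simp)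

theorem integrable_mul_of_continuous {n : ℕ} {Ω : Set (E n)} {u φ : E n → ℝ}
    (hu : Integrable u (volume.restrict Ω)) (hφ : Continuous φ) (hc : HasCompactSupport φ) :
    Integrable (fun x => u x * φ x) (volume.restrict Ω) := by
  obtain ⟨C, hC⟩ := hc.exists_bound_of_continuous hφ
  exact hu.mul_bdd hφ.aestronglyMeasurable (Eventually.of_forall hC)

/-- A compactly supported `C¹` function in `Ω` is approximated uniformly, with its partial
derivatives, by test functions. -/
theorem exists_test_approx {n : ℕ} {Ω : Set (E n)} (hΩ : IsOpen Ω) {ψ : E n → ℝ}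
    (hψ : ContDiff ℝ 1 ψ) (hc : HasCompactSupport ψ) (hs : tsupport ψ ⊆ Ω) (i : Fin n)
    {ε : ℝ} (hε : 0 < ε) :
    ∃ φ, IsTest Ω φ ∧ ∀ x, |φ x - ψ x| ≤ ε ∧ |partialDeriv i φ x - partialDeriv i ψ x| ≤ ε := by
  have hd := partialDeriv_continuous hψ i
  have hdc := partialDeriv_hasCompactSupport hc i
  obtain ⟨δ₁, h1, h1'⟩ := Metric.uniformContinuous_iff.1
    (hc.uniformContinuous_of_continuous hψ.continuous) ε hε
  obtain ⟨δ₂, h2, h2'⟩ := Metric.uniformContinuous_iff.1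
    (hdc.uniformContinuous_of_continuous hd) ε hε
  obtain ⟨δ₃, h3, h3'⟩ := (show IsCompact (tsupport ψ) from hc).exists_cthickening_subset_open hΩ hs
  set δ := min δ₁ (min δ₂ δ₃) with hδ
  have hδ0 : 0 < δ := lt_min h1 (lt_min h2 h3)
  let b : ContDiffBump (0 : E n) := ⟨δ / 2, δ, by positivity, by linarith⟩
  set φ : E n → ℝ := MeasureTheory.convolution (b.normed volume) ψ
    (ContinuousLinearMap.lsmul ℝ ℝ) volume with hφ
  have hbl : LocallyIntegrable (b.normed (volume : Measure (E n))) volume :=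
    b.continuous_normed.locallyIntegrable
  have hsub : tsupport φ ⊆ Metric.cthickening δ₃ (tsupport ψ) := by
    refine closure_minimal ?_ Metric.isClosed_cthickening
    intro x hx
    obtain ⟨y, hy, z, hz, rfl⟩ := support_convolution_subset _ hx
    rw [b.support_normed_eq] at hy
    refine Metric.mem_cthickening_of_dist_le _ z _ _ (subset_tsupport _ hz) ?_
    have : dist y 0 < δ := hy
    simp only [dist_zero_right] at this
    rw [show dist (y + z) z = ‖y‖ by simp [dist_eq_norm]]
    exact this.le.trans ((min_le_right _ _).trans (min_le_right _ _))
  refine ⟨φ, ⟨?_, ?_, hsub.trans h3'⟩, fun x => ⟨?_, ?_⟩⟩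
  · exact b.hasCompactSupport_normed.contDiff_convolution_left _ b.contDiff_normed
      hψ.continuous.locallyIntegrable
  · exact HasCompactSupport.intro (K := Metric.cthickening δ₃ (tsupport ψ))
      (IsCompact.cthickening hc) fun x hx => by
        by_contra h
        exact hx (hsub (subset_tsupport _ h))
  · refine ContDiffBump.dist_normed_convolution_le hψ.continuous.aestronglyMeasurable
      fun y hy => (h1' ?_).le
    exact (Metric.mem_ball.1 hy).trans_le (min_le_left _ _)
  · have hder := (hc.hasFDerivAt_convolution_right (ContinuousLinearMap.lsmul ℝ ℝ) hbl hψ x).fderiv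
    have : partialDeriv i φ x = MeasureTheory.convolution (b.normed volume) (partialDeriv i ψ)
        (ContinuousLinearMap.lsmul ℝ ℝ) volume x := by
      rw [partialDeriv, hφ, hder]
      exact convolution_precompR_apply _ hbl (hc.fderiv ℝ) (hψ.continuous_fderiv (by simp)) _ _
    rw [this]
    refine ContDiffBump.dist_normed_convolution_le hd.aestronglyMeasurable
      fun y hy => (h2' ?_).le
    exact (Metric.mem_ball.1 hy).trans_le ((min_le_right _ _).trans (min_le_left _ _))

/-- The defining identity of weak derivatives extends to compactly supported `C¹` functions. -/
theorem IsWeakPartial.of_C1 {n : ℕ} {Ω : Set (E n)} (hΩ : IsOpen Ω) {i : Fin n} {u v : E n → ℝ}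
    (hu : Integrable u (volume.restrict Ω)) (hv : Integrable v (volume.restrict Ω))
    (h : IsWeakPartial Ω i u v) {ψ : E n → ℝ}
    (hψ : ContDiff ℝ 1 ψ) (hc : HasCompactSupport ψ) (hs : tsupport ψ ⊆ Ω) :
    ∫ x in Ω, u x * partialDeriv i ψ x = - ∫ x in Ω, v x * ψ x := by
  set C := (∫ x in Ω, ‖u x‖) + ∫ x in Ω, ‖v x‖
  have key : ∀ ε : ℝ, 0 < ε →
      |(∫ x in Ω, u x * partialDeriv i ψ x) + ∫ x in Ω, v x * ψ x| ≤ ε * C := by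
    intro ε hε
    obtain ⟨φ, hφ, hφ'⟩ := exists_test_approx hΩ hψ hc hs i hε
    have e := h φ hφ
    have hφ1 : ContDiff ℝ 1 φ := hφ.1.of_le (by exact_mod_cast le_top)
    have i1 := integrable_mul_of_continuous hu (partialDeriv_continuous hψ i)
      (partialDeriv_hasCompactSupport hc i)
    have i2 := integrable_mul_of_continuous hv hψ.continuous hc
    have i3 := integrable_mul_of_continuous hu (partialDeriv_continuous hφ1 i)
      (partialDeriv_hasCompactSupport hφ.2.1 i)
    have i4 := integrable_mul_of_continuous hv hφ1.continuous hφ.2.1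
    have e2 : (∫ x in Ω, u x * partialDeriv i ψ x) + ∫ x in Ω, v x * ψ x
        = ∫ x in Ω, ((u x * partialDeriv i ψ x - u x * partialDeriv i φ x)
          + (v x * ψ x - v x * φ x)) := by
      have := integral_add (i1.sub i3) (i2.sub i4)
      simp only [Pi.sub_apply] at this
      rw [this, integral_sub i1 i3, integral_sub i2 i4]
      linarith
    rw [e2, mul_add, ← integral_const_mul, ← integral_const_mul,
      ← integral_add (hu.norm.const_mul ε) (hv.norm.const_mul ε)]
    rw [← Real.norm_eq_abs]
    refine norm_integral_le_of_norm_le (g := fun x => ε * ‖u x‖ + ε * ‖v x‖)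
      ((hu.norm.const_mul ε).add (hv.norm.const_mul ε)) (Eventually.of_forall fun x => ?_)
    refine (norm_add_le _ _).trans (add_le_add ?_ ?_)
    · rw [← mul_sub, norm_mul, mul_comm]
      refine mul_le_mul_of_nonneg_right ?_ (norm_nonneg _)
      rw [norm_sub_rev]; exact (hφ' x).2
    · rw [← mul_sub, norm_mul, mul_comm]
      refine mul_le_mul_of_nonneg_right ?_ (norm_nonneg _)
      rw [norm_sub_rev]; exact (hφ' x).1
  have h0 : |(∫ x in Ω, u x * partialDeriv i ψ x) + ∫ x in Ω, v x * ψ x| ≤ 0 := by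
    have ht : Tendsto (fun ε : ℝ => ε * C) (𝓝[>] 0) (𝓝 0) := by
      have : Tendsto (fun ε : ℝ => ε * C) (𝓝 0) (𝓝 (0 * C)) :=
        (continuous_id.mul continuous_const).tendsto 0
      rw [zero_mul] at this
      exact this.mono_left nhdsWithin_le_nhds
    exact ge_of_tendsto ht (eventually_mem_nhdsWithin.mono fun ε hε => key ε hε)
  have := abs_nonpos_iff.1 h0
  linarith

/-- Product rule: `D_i (g u) = g D_i u + (D_i g) u` weakly, for `g ∈ C¹(Ω)`. -/
theorem IsWeakPartial.mul_C1 {n : ℕ} {Ω : Set (E n)} (hΩ : IsOpen Ω) {i : Fin n} {u v g : E n → ℝ}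
    (hu : Integrable u (volume.restrict Ω)) (hv : Integrable v (volume.restrict Ω))
    (h : IsWeakPartial Ω i u v) (hg : ContDiffOn ℝ 1 g Ω)
    (hgu : Integrable (fun x => g x * u x) (volume.restrict Ω))
    (hgv : Integrable (fun x => g x * v x) (volume.restrict Ω))
    (hdu : Integrable (fun x => partialDeriv i g x * u x) (volume.restrict Ω)) :
    IsWeakPartial Ω i (fun x => g x * u x) (fun x => g x * v x + partialDeriv i g x * u x) := by
  intro φ hφ
  have hφ1 : ContDiff ℝ 1 φ := hφ.1.of_le (by exact_mod_cast le_top)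
  have hts : tsupport (fun x => g x * φ x) ⊆ tsupport φ := tsupport_mul_subset_right
  have hψ : ContDiff ℝ 1 (fun x => g x * φ x) := by
    refine contDiff_iff_contDiffAt.2 fun x => ?_
    by_cases hx : x ∈ tsupport φ
    · exact (hg.contDiffAt (hΩ.mem_nhds (hφ.2.2 hx))).mul hφ1.contDiffAt
    · have h0 := notMem_tsupport_iff_eventuallyEq.1 (fun hh => hx (hts hh))
      exact contDiffAt_const.congr_of_eventuallyEq h0
  have hψc : HasCompactSupport (fun x => g x * φ x) := hφ.2.1.mul_left
  have e := h.of_C1 hΩ hu hv hψ hψc (hts.trans hφ.2.2)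
  have hp : ∀ x ∈ Ω, partialDeriv i (fun x => g x * φ x) x
      = g x * partialDeriv i φ x + partialDeriv i g x * φ x := by
    intro x hx
    have h1 : DifferentiableAt ℝ g x :=
      (hg.contDiffAt (hΩ.mem_nhds hx)).differentiableAt (by simp)
    have h2 : DifferentiableAt ℝ φ x := (hφ1.differentiable (by simp)) x
    simp only [partialDeriv]
    rw [fderiv_fun_mul h1 h2]
    simp only [_root_.add_apply, _root_.smul_apply, smul_eq_mul]
    ring
  have i1 := integrable_mul_of_continuous hgu (partialDeriv_continuous hφ1 i)
      (partialDeriv_hasCompactSupport hφ.2.1 i)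
  have i2 := integrable_mul_of_continuous hgv hφ1.continuous hφ.2.1
  have i3 := integrable_mul_of_continuous hdu hφ1.continuous hφ.2.1
  have e1 : ∫ x in Ω, u x * partialDeriv i (fun x => g x * φ x) x
      = (∫ x in Ω, g x * u x * partialDeriv i φ x) + ∫ x in Ω, partialDeriv i g x * u x * φ x := by
    rw [← integral_add i1 i3]
    refine setIntegral_congr_fun hΩ.measurableSet fun x hx => ?_
    simp only [hp x hx]; ring
  have e2 : ∫ x in Ω, v x * (g x * φ x) = ∫ x in Ω, g x * v x * φ x :=
    integral_congr_ae (Eventually.of_forall fun x => by ring)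
  have e3 : ∫ x in Ω, (g x * v x + partialDeriv i g x * u x) * φ x
      = (∫ x in Ω, g x * v x * φ x) + ∫ x in Ω, partialDeriv i g x * u x * φ x := by
    rw [← integral_add i2 i3]
    exact integral_congr_ae (Eventually.of_forall fun x => by ring)
  rw [e3]
  rw [e1, e2] at e
  linarith

theorem IsWeakPartial.unique {n : ℕ} {Ω : Set (E n)} (hΩ : IsOpen Ω) {i : Fin n}
    {u v w : E n → ℝ} (hv : Integrable v (volume.restrict Ω))
    (hw : Integrable w (volume.restrict Ω)) (h : IsWeakPartial Ω i u v)
    (h' : IsWeakPartial Ω i u w) : v =ᵐ[volume.restrict Ω] w := by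
  have hl : LocallyIntegrableOn (fun x => v x - w x) Ω volume :=
    (show IntegrableOn _ Ω volume from hv.sub hw).locallyIntegrableOn
  have := hΩ.ae_eq_zero_of_integral_contDiff_smul_eq_zero hl fun φ h1 h2 h3 => by
    have e := (h φ ⟨h1, h2, h3⟩).symm.trans (h' φ ⟨h1, h2, h3⟩)
    have i1 := integrable_mul_of_continuous hv h1.continuous h2
    have i2 := integrable_mul_of_continuous hw h1.continuous h2
    have e0 : ∫ x, φ x • (v x - w x) = ∫ x in Ω, φ x • (v x - w x) := by
      refine (setIntegral_eq_integral_of_forall_compl_eq_zero fun x hx => ?_).symm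
      rw [image_eq_zero_of_notMem_tsupport (fun hh => hx (h3 hh)), zero_smul]
    rw [e0]
    have e1 : ∫ x in Ω, φ x • (v x - w x) = (∫ x in Ω, v x * φ x) - ∫ x in Ω, w x * φ x := by
      rw [← integral_sub i1 i2]
      exact integral_congr_ae (Eventually.of_forall fun x => by simp only [smul_eq_mul]; ring)
    rw [e1]; linarith
  rw [EventuallyEq, ae_restrict_iff' hΩ.measurableSet]
  filter_upwards [this] with x hx hxΩ
  exact sub_eq_zero.1 (hx hxΩ)

theorem IsWeakPartial.congr {n : ℕ} {Ω : Set (E n)} {i : Fin n} {u v u' v' : E n → ℝ}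
    (h : IsWeakPartial Ω i u v) (hu : u' =ᵐ[volume.restrict Ω] u)
    (hv : v' =ᵐ[volume.restrict Ω] v) : IsWeakPartial Ω i u' v' := by
  intro φ hφ
  rw [integral_congr_ae (g := fun x => u x * partialDeriv i φ x)
      (by filter_upwards [hu] with x hx; rw [hx]),
    integral_congr_ae (f := fun x => v' x * φ x) (g := fun x => v x * φ x)
      (by filter_upwards [hv] with x hx; rw [hx])]
  exact h φ hφ

theorem IsWeakPartial.add {n : ℕ} {Ω : Set (E n)} {i : Fin n} {u v u' v' : E n → ℝ}
    (hu : Integrable u (volume.restrict Ω)) (hv : Integrable v (volume.restrict Ω))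
    (hu' : Integrable u' (volume.restrict Ω)) (hv' : Integrable v' (volume.restrict Ω))
    (h : IsWeakPartial Ω i u v) (h' : IsWeakPartial Ω i u' v') :
    IsWeakPartial Ω i (u + u') (v + v') := by
  intro φ hφ
  have hφ1 : ContDiff ℝ 1 φ := hφ.1.of_le (by exact_mod_cast le_top)
  simp only [Pi.add_apply, add_mul]
  rw [integral_add (integrable_mul_of_continuous hu (partialDeriv_continuous hφ1 i)
      (partialDeriv_hasCompactSupport hφ.2.1 i))
      (integrable_mul_of_continuous hu' (partialDeriv_continuous hφ1 i)
      (partialDeriv_hasCompactSupport hφ.2.1 i)),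
    integral_add (integrable_mul_of_continuous hv hφ1.continuous hφ.2.1)
      (integrable_mul_of_continuous hv' hφ1.continuous hφ.2.1), h φ hφ, h' φ hφ]
  ring

theorem IsWeakPartial.smul {n : ℕ} {Ω : Set (E n)} {i : Fin n} {u v : E n → ℝ} (c : ℝ)
    (h : IsWeakPartial Ω i u v) : IsWeakPartial Ω i (c • u) (c • v) := by
  intro φ hφ
  simp only [Pi.smul_apply, smul_eq_mul, mul_assoc]
  rw [integral_const_mul, integral_const_mul, h φ hφ]
  ring

/-! ### Lebesgue and Sobolev spaces on a bounded open set -/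

/-- The real Lebesgue space `L^p(Ω)`. -/
abbrev LpOn {n : ℕ} (Ω : Set (E n)) (p : ℝ≥0∞) : Type :=
  ↥(Lp ℝ p (volume.restrict Ω))

theorem LpOn.integrable {n : ℕ} {Ω : Set (E n)} (hb : Bornology.IsBounded Ω) {p : ℝ≥0∞}
    [hp : Fact (1 ≤ p)] (u : LpOn Ω p) : Integrable u (volume.restrict Ω) := by
  have := isFiniteMeasure_of_bounded hb
  exact (Lp.memLp u).integrable hp.out

/-- The embedding `L^p(Ω) ⊆ L²(Ω)`, `p ≥ 2`, for bounded `Ω`. -/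
def toL2 {n : ℕ} {Ω : Set (E n)} (hb : Bornology.IsBounded Ω) {p : ℝ≥0∞} (hp : 2 ≤ p) :
    LpOn Ω p →ₗ[ℝ] LpOn Ω 2 :=
  haveI := isFiniteMeasure_of_bounded hb
  { toFun := fun u => ((Lp.memLp u).mono_exponent hp).toLp u
    map_add' := fun u v => by
      rw [← MemLp.toLp_add]
      exact MemLp.toLp_congr _ _ (Lp.coeFn_add u v)
    map_smul' := fun c u => by
      rw [RingHom.id_apply, ← MemLp.toLp_const_smul]
      exact MemLp.toLp_congr _ _ (Lp.coeFn_smul c u) }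

/-- The weak partial derivative `D_i u` of `u ∈ L^p(Ω)` as an element of `L^p(Ω)`; it is unique when
it exists, and we set it to `0` when it does not. -/
def weakPartial {n : ℕ} (Ω : Set (E n)) {p : ℝ≥0∞} (i : Fin n) (u : LpOn Ω p) : LpOn Ω p :=
  open Classical in
  if h : ∃ v : LpOn Ω p, IsWeakPartial Ω i u v then h.choose else 0

theorem weakPartial_eq {n : ℕ} {Ω : Set (E n)} (hΩ : IsOpen Ω) (hb : Bornology.IsBounded Ω)
    {p : ℝ≥0∞} [Fact (1 ≤ p)] {i : Fin n} {u v : LpOn Ω p} (h : IsWeakPartial Ω i u v) :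
    weakPartial Ω i u = v := by
  have h' : ∃ v : LpOn Ω p, IsWeakPartial Ω i u v := ⟨v, h⟩
  rw [weakPartial, dif_pos h']
  exact Lp.ext (h'.choose_spec.unique hΩ (LpOn.integrable hb _) (LpOn.integrable hb _) h)

theorem weakPartial_spec {n : ℕ} {Ω : Set (E n)} {p : ℝ≥0∞} {i : Fin n} {u : LpOn Ω p}
    (h : ∃ v : LpOn Ω p, IsWeakPartial Ω i u v) : IsWeakPartial Ω i u (weakPartial Ω i u) := by
  rw [weakPartial, dif_pos h]
  exact h.choose_spec

theorem LpOn.isWeakPartial_add {n : ℕ} {Ω : Set (E n)} (hb : Bornology.IsBounded Ω)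
    {p : ℝ≥0∞} [Fact (1 ≤ p)] {i : Fin n} {u v u' v' : LpOn Ω p} (h : IsWeakPartial Ω i u v)
    (h' : IsWeakPartial Ω i u' v') :
    IsWeakPartial Ω i (u + u' : LpOn Ω p) (v + v' : LpOn Ω p) :=
  (h.add (LpOn.integrable hb _) (LpOn.integrable hb _) (LpOn.integrable hb _)
    (LpOn.integrable hb _) h').congr (Lp.coeFn_add _ _) (Lp.coeFn_add _ _)

theorem LpOn.isWeakPartial_smul {n : ℕ} {Ω : Set (E n)}
    {p : ℝ≥0∞} {i : Fin n} {u v : LpOn Ω p} (c : ℝ) (h : IsWeakPartial Ω i u v) :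
    IsWeakPartial Ω i (c • u : LpOn Ω p) (c • v : LpOn Ω p) :=
  (h.smul c).congr (Lp.coeFn_smul _ _) (Lp.coeFn_smul _ _)

theorem isWeakPartial_zero {n : ℕ} {Ω : Set (E n)} {p : ℝ≥0∞} {i : Fin n} :
    IsWeakPartial Ω i (0 : LpOn Ω p) (0 : LpOn Ω p) := by
  refine IsWeakPartial.congr (u := 0) (v := 0) (fun φ _ => by simp) ?_ ?_ <;>
    exact Lp.coeFn_zero _ _ _

/-- The Sobolev space `W^{1,p}(Ω)`. -/
def W1 {n : ℕ} {Ω : Set (E n)} (hb : Bornology.IsBounded Ω) (p : ℝ≥0∞) [Fact (1 ≤ p)] :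
    Submodule ℝ (LpOn Ω p) where
  carrier := {u | ∀ i, ∃ v : LpOn Ω p, IsWeakPartial Ω i u v}
  zero_mem' := fun _ => ⟨0, isWeakPartial_zero⟩
  add_mem' := fun hu hv i =>
    ⟨_, LpOn.isWeakPartial_add hb (hu i).choose_spec (hv i).choose_spec⟩
  smul_mem' := fun c _ hu i => ⟨_, LpOn.isWeakPartial_smul c (hu i).choose_spec⟩

theorem weakPartial_add {n : ℕ} {Ω : Set (E n)} (hΩ : IsOpen Ω) (hb : Bornology.IsBounded Ω)
    {p : ℝ≥0∞} [Fact (1 ≤ p)] (i : Fin n) {u v : LpOn Ω p} (hu : u ∈ W1 hb p)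
    (hv : v ∈ W1 hb p) :
    weakPartial Ω i (u + v) = weakPartial Ω i u + weakPartial Ω i v :=
  weakPartial_eq hΩ hb
    (LpOn.isWeakPartial_add hb (weakPartial_spec (hu i)) (weakPartial_spec (hv i)))

theorem weakPartial_smul {n : ℕ} {Ω : Set (E n)} (hΩ : IsOpen Ω) (hb : Bornology.IsBounded Ω)
    {p : ℝ≥0∞} [Fact (1 ≤ p)] (i : Fin n) (c : ℝ) {u : LpOn Ω p} (hu : u ∈ W1 hb p) :
    weakPartial Ω i (c • u) = c • weakPartial Ω i u :=
  weakPartial_eq hΩ hb (LpOn.isWeakPartial_smul c (weakPartial_spec (hu i)))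

theorem weakPartial_zero {n : ℕ} {Ω : Set (E n)} (hΩ : IsOpen Ω) (hb : Bornology.IsBounded Ω)
    {p : ℝ≥0∞} [Fact (1 ≤ p)] (i : Fin n) : weakPartial Ω i (0 : LpOn Ω p) = 0 :=
  weakPartial_eq hΩ hb isWeakPartial_zero

/-- The Sobolev space `W^{2,p}(Ω)`. -/
def W2 {n : ℕ} {Ω : Set (E n)} (hΩ : IsOpen Ω) (hb : Bornology.IsBounded Ω) (p : ℝ≥0∞)
    [Fact (1 ≤ p)] : Submodule ℝ (LpOn Ω p) where
  carrier := {u | u ∈ W1 hb p ∧ ∀ i, weakPartial Ω i u ∈ W1 hb p}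
  zero_mem' := ⟨zero_mem _, fun i => by rw [weakPartial_zero hΩ hb]; exact zero_mem _⟩
  add_mem' := fun hu hv => ⟨add_mem hu.1 hv.1, fun i => by
    rw [weakPartial_add hΩ hb i hu.1 hv.1]; exact add_mem (hu.2 i) (hv.2 i)⟩
  smul_mem' := fun c _ hu => ⟨Submodule.smul_mem _ c hu.1, fun i => by
    rw [weakPartial_smul hΩ hb i c hu.1]; exact Submodule.smul_mem _ c (hu.2 i)⟩

theorem IsTest.differentiable {n : ℕ} {Ω : Set (E n)} {φ : E n → ℝ} (h : IsTest Ω φ) :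
    Differentiable ℝ φ := h.1.differentiable (by simp)

/-- The pairs `(φ, ∇φ)` in `L^p(Ω) × L^p(Ω)ⁿ`, with `φ` a test function. -/
def testJets {n : ℕ} (Ω : Set (E n)) (p : ℝ≥0∞) [Fact (1 ≤ p)] :
    Submodule ℝ (LpOn Ω p × (Fin n → LpOn Ω p)) where
  carrier := {q | ∃ φ : E n → ℝ, IsTest Ω φ ∧ q.1 =ᵐ[volume.restrict Ω] φ ∧
    ∀ i, q.2 i =ᵐ[volume.restrict Ω] partialDeriv i φ}
  zero_mem' := by
    refine ⟨0, ⟨contDiff_const, HasCompactSupport.zero, by simp [tsupport]⟩,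
      Lp.coeFn_zero _ _ _, fun i => (Lp.coeFn_zero _ _ _).trans ?_⟩
    refine Eventually.of_forall fun x => ?_
    simp [partialDeriv]
  add_mem' := by
    rintro q r ⟨φ, hφ, h1, h2⟩ ⟨ψ, hψ, h3, h4⟩
    refine ⟨φ + ψ, ⟨hφ.1.add hψ.1, hφ.2.1.add hψ.2.1,
      (tsupport_add φ ψ).trans (union_subset hφ.2.2 hψ.2.2)⟩,
      (Lp.coeFn_add _ _).trans (h1.add h3), fun i => (Lp.coeFn_add _ _).trans ?_⟩
    refine ((h2 i).add (h4 i)).trans (Eventually.of_forall fun x => ?_)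
    simp [partialDeriv, fderiv_add (hφ.differentiable x) (hψ.differentiable x)]
  smul_mem' := by
    rintro c q ⟨φ, hφ, h1, h2⟩
    refine ⟨c • φ, ⟨contDiff_const.smul hφ.1, hφ.2.1.smul_left (f := fun _ => c),
      (tsupport_smul_subset_right (fun _ => c) φ).trans hφ.2.2⟩,
      (Lp.coeFn_smul _ _).trans (h1.const_smul c), fun i => (Lp.coeFn_smul _ _).trans ?_⟩
    refine ((h2 i).const_smul c).trans (Eventually.of_forall fun x => ?_)
    simp [partialDeriv, fderiv_const_smul (hφ.differentiable x)]

/-- The Sobolev space `W_0^{1,p}(Ω)`: the closure of the test functions in `W^{1,p}(Ω)`. -/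
def W10 {n : ℕ} {Ω : Set (E n)} (hΩ : IsOpen Ω) (hb : Bornology.IsBounded Ω) (p : ℝ≥0∞)
    [Fact (1 ≤ p)] : Submodule ℝ (LpOn Ω p) where
  carrier := {u | u ∈ W1 hb p ∧
    (u, fun i => weakPartial Ω i u) ∈ (testJets Ω p).topologicalClosure}
  zero_mem' := ⟨zero_mem _, by
    simp only [weakPartial_zero hΩ hb]; exact zero_mem _⟩
  add_mem' := fun hu hv => ⟨add_mem hu.1 hv.1, by
    simp only [weakPartial_add hΩ hb _ hu.1 hv.1]; exact add_mem hu.2 hv.2⟩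
  smul_mem' := fun c _ hu => ⟨Submodule.smul_mem _ c hu.1, by
    simp only [weakPartial_smul hΩ hb _ c hu.1]; exact Submodule.smul_mem _ c hu.2⟩

/-! ### The elliptic operator -/

theorem IsC1Closure.exists_bound {n : ℕ} {Ω : Set (E n)} (hb : Bornology.IsBounded Ω)
    {g : E n → ℝ} (hg : IsC1Closure Ω g) : ∃ C, ∀ x ∈ Ω, ‖g x‖ ≤ C := by
  obtain ⟨C, hC⟩ := hb.isCompact_closure.exists_bound_of_continuousOn hg.2.1
  exact ⟨C, fun x hx => hC x (subset_closure hx)⟩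

theorem IsC1Closure.exists_bound_partialDeriv {n : ℕ} {Ω : Set (E n)}
    (hb : Bornology.IsBounded Ω) {g : E n → ℝ} (hg : IsC1Closure Ω g) (i : Fin n) :
    ∃ C, ∀ x ∈ Ω, ‖partialDeriv i g x‖ ≤ C := by
  obtain ⟨G, hG, hG'⟩ := hg.2.2
  obtain ⟨C, hC⟩ := hb.isCompact_closure.exists_bound_of_continuousOn
    (hG.clm_apply (continuousOn_const (c := EuclideanSpace.single i (1 : ℝ))))
  exact ⟨C, fun x hx => by
    rw [partialDeriv, ← hG' hx]; exact hC x (subset_closure hx)⟩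

theorem memLp_mul_of_bound {n : ℕ} {Ω : Set (E n)} (hΩ : IsOpen Ω) {p : ℝ≥0∞} {g : E n → ℝ}
    (hm : AEStronglyMeasurable g (volume.restrict Ω)) (hg : ∃ C, ∀ x ∈ Ω, ‖g x‖ ≤ C)
    (u : LpOn Ω p) : MemLp (fun x => g x * u x) p (volume.restrict Ω) := by
  obtain ⟨C, hC⟩ := hg
  refine (Lp.memLp u).of_le_mul (c := C) (hm.mul (Lp.aestronglyMeasurable u)) ?_
  filter_upwards [ae_restrict_mem hΩ.measurableSet] with x hx
  rw [norm_mul]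
  exact mul_le_mul_of_nonneg_right (hC x hx) (norm_nonneg _)

theorem IsC1Closure.memLp_mul {n : ℕ} {Ω : Set (E n)} (hΩ : IsOpen Ω)
    (hb : Bornology.IsBounded Ω) {p : ℝ≥0∞} {g : E n → ℝ} (hg : IsC1Closure Ω g) (u : LpOn Ω p) :
    MemLp (fun x => g x * u x) p (volume.restrict Ω) :=
  memLp_mul_of_bound hΩ (hg.1.continuousOn.aestronglyMeasurable hΩ.measurableSet)
    (hg.exists_bound hb) u

/-- Multiplication by a function of class `C¹(closure Ω)` in `L^p(Ω)`. -/
def mulC1 {n : ℕ} {Ω : Set (E n)} (hΩ : IsOpen Ω) (hb : Bornology.IsBounded Ω) (p : ℝ≥0∞)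
    {g : E n → ℝ} (hg : IsC1Closure Ω g) : LpOn Ω p →ₗ[ℝ] LpOn Ω p where
  toFun u := (hg.memLp_mul hΩ hb u).toLp _
  map_add' u v := by
    rw [← MemLp.toLp_add]
    refine MemLp.toLp_congr _ _ ?_
    filter_upwards [Lp.coeFn_add u v] with x hx
    simp only [Pi.add_apply] at hx ⊢
    rw [hx]; ring
  map_smul' c u := by
    rw [RingHom.id_apply, ← MemLp.toLp_const_smul]
    refine MemLp.toLp_congr _ _ ?_
    filter_upwards [Lp.coeFn_smul c u] with x hx
    simp only [Pi.smul_apply, smul_eq_mul] at hx ⊢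
    rw [hx]; ring

theorem mulC1_mem_W1 {n : ℕ} {Ω : Set (E n)} (hΩ : IsOpen Ω) (hb : Bornology.IsBounded Ω)
    {p : ℝ≥0∞} [hp : Fact (1 ≤ p)] {g : E n → ℝ} (hg : IsC1Closure Ω g) {u : LpOn Ω p}
    (hu : u ∈ W1 hb p) : mulC1 hΩ hb p hg u ∈ W1 hb p := by
  intro i
  have := isFiniteMeasure_of_bounded hb
  obtain ⟨v, hv⟩ := hu i
  have m1 := hg.memLp_mul hΩ hb u
  have m2 := hg.memLp_mul hΩ hb v
  have m3 := memLp_mul_of_bound hΩ (g := partialDeriv i g)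
    (measurable_fderiv_apply_const ℝ g _).aestronglyMeasurable
    (hg.exists_bound_partialDeriv hb i) u
  refine ⟨(m2.add m3).toLp _, ?_⟩
  have m1' : (mulC1 hΩ hb p hg u : E n → ℝ) =ᵐ[volume.restrict Ω] fun x => g x * u x :=
    MemLp.coeFn_toLp m1
  exact (hv.mul_C1 hΩ (LpOn.integrable hb _) (LpOn.integrable hb _) hg.1 (m1.integrable hp.out)
    (m2.integrable hp.out) (m3.integrable hp.out)).congr m1' (MemLp.coeFn_toLp _)

/-- The operator `A_p u = - ∑ D_j (a_ij D_i u)` in `L^p(Ω)`, with the domain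
`W^{2,p}(Ω) ∩ W_0^{1,p}(Ω)`. -/
def ellipticOp {n : ℕ} {Ω : Set (E n)} (hΩ : IsOpen Ω) (hb : Bornology.IsBounded Ω)
    {a : Fin n → Fin n → E n → ℝ} (ha : IsEllipticCoeff Ω a) (p : ℝ≥0∞) [Fact (1 ≤ p)] :
    LpOn Ω p →ₗ.[ℝ] LpOn Ω p where
  domain := W2 hΩ hb p ⊓ W10 hΩ hb p
  toFun :=
    { toFun := fun u =>
        - ∑ i, ∑ j, weakPartial Ω j (mulC1 hΩ hb p (ha.smooth i j) (weakPartial Ω i u.1))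
      map_add' := fun u v => by
        rw [← neg_add, ← Finset.sum_add_distrib]
        congr 1
        refine Finset.sum_congr rfl fun i _ => ?_
        rw [← Finset.sum_add_distrib]
        refine Finset.sum_congr rfl fun j _ => ?_
        rw [← weakPartial_add hΩ hb j (mulC1_mem_W1 hΩ hb _ (u.2.1.2 i))
          (mulC1_mem_W1 hΩ hb _ (v.2.1.2 i)), ← map_add,
          ← weakPartial_add hΩ hb i u.2.1.1 v.2.1.1]
        rfl
      map_smul' := fun c u => by
        rw [RingHom.id_apply, smul_neg, Finset.smul_sum]
        congr 1
        refine Finset.sum_congr rfl fun i _ => ?_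
        rw [Finset.smul_sum]
        refine Finset.sum_congr rfl fun j _ => ?_
        rw [← weakPartial_smul hΩ hb j c (mulC1_mem_W1 hΩ hb _ (u.2.1.2 i)), ← map_smul,
          ← weakPartial_smul hΩ hb i c u.2.1.1]
        rfl }

/-! ### Semigroups, fractional powers and fractional spaces -/

section Abstract

variable {X : Type*} [NormedAddCommGroup X] [NormedSpace ℝ X]

/-- `(S t)_{t ≥ 0}` is a strongly continuous semigroup of bounded operators whose infinitesimal
generator is `B` (only the values `S t` with `t ≥ 0` matter). -/
structure IsC0SemigroupOf (B : X →ₗ.[ℝ] X) (S : ℝ → X →L[ℝ] X) : Prop where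
  zero : S 0 = ContinuousLinearMap.id ℝ X
  add : ∀ s t : ℝ, 0 ≤ s → 0 ≤ t → S (s + t) = (S s).comp (S t)
  cont : ∀ x : X, Tendsto (fun t => S t x) (𝓝[>] 0) (𝓝 x)
  generator : ∀ x y : X, (x, y) ∈ B.graph ↔
    Tendsto (fun t : ℝ => t⁻¹ • (S t x - x)) (𝓝[>] 0) (𝓝 y)

/-- The semigroup `S_A` whose infinitesimal generator is `-A` (restricted to `t ≥ 0` it is unique;
we set it to `0` if `-A` is not a generator). -/
def semigroupOf (A : X →ₗ.[ℝ] X) : ℝ → X →L[ℝ] X :=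
  open Classical in
  if h : ∃ S : ℝ → X →L[ℝ] X, IsC0SemigroupOf (-A) S then h.choose else 0

/-- `A^{-α} = Γ(α)⁻¹ ∫₀^∞ t^{α-1} S_A(t) dt`, an integral in the Banach space of bounded operators
with the operator norm. -/
def fracInv (A : X →ₗ.[ℝ] X) (α : ℝ) : X →L[ℝ] X :=
  (Real.Gamma α)⁻¹ • ∫ t in Ioi (0 : ℝ), t ^ (α - 1) • semigroupOf A t

/-- The fractional space `X^α = D(A^α)`, the range of `A^{-α}`. -/
def fracSpace (A : X →ₗ.[ℝ] X) (α : ℝ) : Submodule ℝ X :=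
  LinearMap.range (fracInv A α).toLinearMap

/-- `A^α`, the inverse of `A^{-α}` on its range `X^α`. -/
def fracPow (A : X →ₗ.[ℝ] X) (α : ℝ) : X → X :=
  Function.invFun (fracInv A α)

/-- The norm `‖x‖_α = ‖A^α x‖` of `X^α`. -/
def fracNorm (A : X →ₗ.[ℝ] X) (α : ℝ) (x : X) : ℝ :=
  ‖fracPow A α x‖

/-- The eigenspace `ker (μ I - A)`. -/
def eigenspace (A : X →ₗ.[ℝ] X) (μ : ℝ) : Submodule ℝ X :=
  A.graph.comap (LinearMap.id.prod (μ • LinearMap.id))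

end Abstract

/-! ### The spectral decomposition `L^p(Ω) = X₊ ⊕ X₋ ⊕ X₀` -/

/-- `X₋`, the sum of the eigenspaces of `A` for the eigenvalues below `μ`. -/
def spaceMinus {X : Type*} [NormedAddCommGroup X] [NormedSpace ℝ X] (A : X →ₗ.[ℝ] X) (μ : ℝ) :
    Submodule ℝ X :=
  ⨆ ν : Iio μ, eigenspace A ν

/-- `X₊`, the complement of `X₀ ⊕ X₋` in `L^p(Ω)` that is orthogonal to it in `L²(Ω)`. -/
def spacePlus {n : ℕ} {Ω : Set (E n)} (hb : Bornology.IsBounded Ω) {p : ℝ≥0∞} [Fact (1 ≤ p)]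
    (hp : 2 ≤ p) (A : LpOn Ω p →ₗ.[ℝ] LpOn Ω p) (μ : ℝ) : Submodule ℝ (LpOn Ω p) :=
  (((eigenspace A μ ⊔ spaceMinus A μ).map (toL2 hb hp))ᗮ).comap (toL2 hb hp)

/-- The space `X₊^α ⊕ X₋^α`, where `X_±^α = X^α ∩ X_±`. -/
def alphaSpace {n : ℕ} {Ω : Set (E n)} (hb : Bornology.IsBounded Ω) {p : ℝ≥0∞} [Fact (1 ≤ p)]
    (hp : 2 ≤ p) (A : LpOn Ω p →ₗ.[ℝ] LpOn Ω p) (α μ : ℝ) : Submodule ℝ (LpOn Ω p) :=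
  (fracSpace A α ⊓ spacePlus hb hp A μ) ⊔ (fracSpace A α ⊓ spaceMinus A μ)

/-! ### The Nemitskii operator -/

theorem memLp_nemitskii {n : ℕ} {Ω : Set (E n)} (hΩ : IsOpen Ω) (hb : Bornology.IsBounded Ω)
    {f : E n → ℝ → ℝ} (hf : ContinuousOn (Function.uncurry f) (Ω ×ˢ univ))
    (hm : ∃ m : ℝ, 0 < m ∧ ∀ x ∈ Ω, ∀ s, |f x s| ≤ m) {p : ℝ≥0∞} (u : LpOn Ω p) :
    MemLp (fun x => f x (u x)) p (volume.restrict Ω) := by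
  have := isFiniteMeasure_of_bounded hb
  obtain ⟨m, -, hm⟩ := hm
  classical
  have hS : MeasurableSet (Ω ×ˢ (univ : Set ℝ)) := hΩ.measurableSet.prod MeasurableSet.univ
  have h1 : Measurable ((Ω ×ˢ (univ : Set ℝ)).piecewise (Function.uncurry f) fun _ => 0) :=
    hf.measurable_piecewise continuousOn_const hS
  have h2 : Measurable fun x => ((Ω ×ˢ (univ : Set ℝ)).piecewise (Function.uncurry f) fun _ => 0)
      (x, u x) := h1.comp (measurable_id.prodMk (Lp.stronglyMeasurable u).measurable)
  refine MemLp.of_bound (h2.aestronglyMeasurable.congr ?_) m ?_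
  · filter_upwards [ae_restrict_mem hΩ.measurableSet] with x hx
    simp [Set.piecewise, hx]
  · filter_upwards [ae_restrict_mem hΩ.measurableSet] with x hx
    exact hm x hx _

/-- The Nemitskii operator `F(u)(x) = f(x, u(x))` of a bounded continuous `f`, with values in
`L^p(Ω)`. -/
def nemitskii {n : ℕ} {Ω : Set (E n)} (hΩ : IsOpen Ω) (hb : Bornology.IsBounded Ω)
    {f : E n → ℝ → ℝ} (hf : ContinuousOn (Function.uncurry f) (Ω ×ˢ univ))
    (hm : ∃ m : ℝ, 0 < m ∧ ∀ x ∈ Ω, ∀ s, |f x s| ≤ m) (p : ℝ≥0∞) (u : LpOn Ω p) : LpOn Ω p :=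
  (memLp_nemitskii hΩ hb hf hm u).toLp _

/-- `⟨u, v⟩` in `L²(Ω)`, for `u, v ∈ L^p(Ω)` and `p ≥ 2`. -/
def innerL2 {n : ℕ} {Ω : Set (E n)} (hb : Bornology.IsBounded Ω) {p : ℝ≥0∞} (hp : 2 ≤ p)
    (u v : LpOn Ω p) : ℝ :=
  inner ℝ (toL2 hb hp u) (toL2 hb hp v)

/-- The expression in the Landesman–Lazer conditions:
`∫_{u > 0} f₊ u + ∫_{u < 0} f₋ u`. -/
def landesmanLazer {n : ℕ} {Ω : Set (E n)} {p : ℝ≥0∞} (fp fm : E n → ℝ) (u : LpOn Ω p) : ℝ :=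
  (∫ x in {x ∈ Ω | 0 < u x}, fp x * u x) + ∫ x in {x ∈ Ω | u x < 0}, fm x * u x

end LL

end

namespace LL

/-! The proof is by contradiction and compactness. If (i) fails, there are `z k`, `y k`, `x k` with
`t k = ‖x k‖₂ → ∞` and `⟨F(z k + x k), x k + y k⟩ ≤ 1/(k+1)`. Divide by `t k`. Since `X₀` is
finite-dimensional, a subsequence of `x k / t k` converges in `L²` to some `v ∈ X₀` of norm one,
while `z k / t k` and `y k / t k` tend to zero. Along a further subsequence `(z k + x k) / t k → v`
almost everywhere, so `z k + x k` tends to `+∞` where `v > 0` and to `-∞` where `v < 0`. As `f` is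
bounded, dominated convergence turns the divided pairings into the Landesman–Lazer expression of
`v`, which is therefore `≤ 0`, against (LL1). Part (ii) is the same with signs reversed
(`tendsto_innerL2_nemitskii`, `exists_subseq_tendsto_landesmanLazer`).

Finite dimension of `X₀` comes from two facts. Testing the eigenvalue equation with `u` itself
bounds `‖∇u‖₂` by a multiple of `‖u‖₂` (`exists_gradient_le_of_mem_eigenspace`). And a quantitative
form of Rellich's theorem bounds the size of an orthonormal family `e k` with bounded gradients
(`card_le_of_orthonormal`): each `e k` is close to its average over balls of a small radius `ε`, so
these averages are not small in `L²`; but the average at `x` is a multiple of the inner product of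
`e k` with the indicator of `B(x, ε)`, so Bessel's inequality bounds the sum of its squares over
`k`. Integration over `Ω` bounds the number of elements.

Of the fractional norm only this is needed: it dominates the `L^p` norm, hence the `L²` norm,
because `A^{-α}` is a bounded operator. -/

/-! ### Averages of test functions over small balls -/

/-- Cauchy–Schwarz on a probability space. With values in `ℝ≥0∞` no integrability has to be assumed.
-/
theorem enorm_integral_sq_le {α : Type*} [MeasurableSpace α] {μ : Measure α}
    [IsProbabilityMeasure μ] {h : α → ℝ} (hh : AEStronglyMeasurable h μ) :
    ‖∫ x, h x ∂μ‖ₑ ^ 2 ≤ ∫⁻ x, ‖h x‖ₑ ^ 2 ∂μ := by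
  have h1 : ‖∫ x, h x ∂μ‖ₑ ≤ eLpNorm h 2 μ := by
    refine (enorm_integral_le_lintegral_enorm h).trans ?_
    rw [← eLpNorm_one_eq_lintegral_enorm]
    exact eLpNorm_le_eLpNorm_of_exponent_le (by norm_num) hh
  refine (pow_le_pow_left' h1 2).trans_eq ?_
  have := eLpNorm_nnreal_pow_eq_lintegral (f := h) (μ := μ) (p := 2) (by norm_num)
  simpa using this

/-- The translation estimate `‖φ(· + y) - φ‖₂ ≤ |y| ‖∇φ‖₂`. -/
theorem lintegral_translate_sub_sq_le {n : ℕ} {φ : E n → ℝ} (hφ : ContDiff ℝ 1 φ) (y : E n) :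
    ∫⁻ x, ‖φ (x + y) - φ x‖ₑ ^ 2 ≤ ‖y‖ₑ ^ 2 * ∫⁻ x, ‖fderiv ℝ φ x‖ₑ ^ 2 := by
  have hc : Continuous (fderiv ℝ φ) := hφ.continuous_fderiv (by simp)
  -- Write the increment as the integral of `Dφ(x + t y) y` over `0 < t ≤ 1`, apply Cauchy–Schwarz
  -- in `t`, then exchange integrals; translation invariance removes `t`.
  let ν : Measure ℝ := volume.restrict (Ioc 0 1)
  have : IsProbabilityMeasure ν := ⟨by simp [ν]⟩
  have h1 : ∀ x, ‖φ (x + y) - φ x‖ₑ ^ 2 ≤ ∫⁻ t, ‖y‖ₑ ^ 2 * ‖fderiv ℝ φ (x + t • y)‖ₑ ^ 2 ∂ν := by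
    intro x
    have hct : Continuous fun t : ℝ => fderiv ℝ φ (x + t • y) y :=
      (hc.comp (by fun_prop)).clm_apply continuous_const
    have e : φ (x + y) - φ x = ∫ t, fderiv ℝ φ (x + t • y) y ∂ν := by
      have := intervalIntegral.integral_eq_sub_of_hasDerivAt (a := 0) (b := 1)
        (f := fun t : ℝ => φ (x + t • y)) (f' := fun t : ℝ => fderiv ℝ φ (x + t • y) y)
        (fun t _ => by
          have h2 := (hφ.differentiable (by simp) (x + t • y)).hasFDerivAt
          have h3 : HasDerivAt (fun t : ℝ => x + t • y) y t := by
            simpa using ((hasDerivAt_id t).smul_const y).const_add x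
          exact h2.comp_hasDerivAt t h3) (hct.intervalIntegrable _ _)
      rw [intervalIntegral.integral_of_le zero_le_one] at this
      simpa using this.symm
    rw [e]
    refine (enorm_integral_sq_le hct.aestronglyMeasurable).trans (lintegral_mono fun t => ?_)
    rw [← mul_pow, mul_comm]
    exact pow_le_pow_left' (ContinuousLinearMap.le_opENorm _ _) 2
  have hm : Measurable fun q : E n × ℝ => ‖y‖ₑ ^ 2 * ‖fderiv ℝ φ (q.1 + q.2 • y)‖ₑ ^ 2 := by
    have : Continuous fun q : E n × ℝ => fderiv ℝ φ (q.1 + q.2 • y) := hc.comp (by fun_prop)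
    exact (this.measurable.enorm.pow_const 2).const_mul _
  calc ∫⁻ x, ‖φ (x + y) - φ x‖ₑ ^ 2
      ≤ ∫⁻ x, ∫⁻ t, ‖y‖ₑ ^ 2 * ‖fderiv ℝ φ (x + t • y)‖ₑ ^ 2 ∂ν := lintegral_mono h1
    _ = ∫⁻ t, ∫⁻ x, ‖y‖ₑ ^ 2 * ‖fderiv ℝ φ (x + t • y)‖ₑ ^ 2 ∂volume ∂ν :=
        lintegral_lintegral_swap hm.aemeasurable
    _ = ∫⁻ _t, ∫⁻ x, ‖y‖ₑ ^ 2 * ‖fderiv ℝ φ x‖ₑ ^ 2 ∂volume ∂ν := by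
        refine lintegral_congr fun t => ?_
        exact lintegral_add_right_eq_self (fun x => ‖y‖ₑ ^ 2 * ‖fderiv ℝ φ x‖ₑ ^ 2) (t • y)
    _ = ‖y‖ₑ ^ 2 * ∫⁻ x, ‖fderiv ℝ φ x‖ₑ ^ 2 := by
        rw [lintegral_const, measure_univ, mul_one, lintegral_const_mul _
          (hc.measurable.enorm.pow_const 2)]

/-- Cauchy–Schwarz moves the square inside the average over `y`; after exchanging integrals the
translation estimate applies to each `y` separately. -/
theorem lintegral_average_sub_sq_le {n : ℕ} {φ : E n → ℝ} (hφ : ContDiff ℝ 1 φ)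
    (hc : HasCompactSupport φ) {μ : Measure (E n)} [IsProbabilityMeasure μ] {ε : ℝ}
    (hμ : ∀ᵐ y ∂μ, ‖y‖ ≤ ε) :
    ∫⁻ x, ‖(∫ y, φ (x + y) ∂μ) - φ x‖ₑ ^ 2 ≤
      ENNReal.ofReal ε ^ 2 * ∫⁻ x, ‖fderiv ℝ φ x‖ₑ ^ 2 := by
  have hcont := hφ.continuous
  obtain ⟨C, hC⟩ := hc.exists_bound_of_continuous hcont
  have hm : Measurable fun q : E n × E n => ‖φ (q.1 + q.2) - φ q.1‖ₑ ^ 2 := by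
    have : Continuous fun q : E n × E n => φ (q.1 + q.2) - φ q.1 := by fun_prop
    exact this.measurable.enorm.pow_const 2
  calc ∫⁻ x, ‖(∫ y, φ (x + y) ∂μ) - φ x‖ₑ ^ 2
      ≤ ∫⁻ x, ∫⁻ y, ‖φ (x + y) - φ x‖ₑ ^ 2 ∂μ := by
        refine lintegral_mono fun x => ?_
        have hx : Continuous fun y => φ (x + y) := by fun_prop
        have hi : Integrable (fun y => φ (x + y)) μ :=
          Integrable.of_bound hx.aestronglyMeasurable C (Eventually.of_forall fun y => hC _)
        have : (∫ y, φ (x + y) ∂μ) - φ x = ∫ y, (φ (x + y) - φ x) ∂μ := by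
          rw [integral_sub hi (integrable_const _)]; simp
        simp only [this]
        exact enorm_integral_sq_le (hx.sub continuous_const).aestronglyMeasurable
    _ = ∫⁻ y, ∫⁻ x, ‖φ (x + y) - φ x‖ₑ ^ 2 ∂volume ∂μ :=
        lintegral_lintegral_swap hm.aemeasurable
    _ ≤ ∫⁻ _y, ENNReal.ofReal ε ^ 2 * ∫⁻ x, ‖fderiv ℝ φ x‖ₑ ^ 2 ∂volume ∂μ := by
        refine lintegral_mono_ae ?_
        filter_upwards [hμ] with y hy
        refine (lintegral_translate_sub_sq_le hφ y).trans ?_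
        gcongr
        rw [← ofReal_norm]
        exact ENNReal.ofReal_le_ofReal hy
    _ = _ := by rw [lintegral_const, measure_univ, mul_one]

/-- The indicator function of the ball `B(x, ε)` in `L²(Ω)`. -/
noncomputable def ballInd {n : ℕ} {Ω : Set (E n)} (hb : Bornology.IsBounded Ω) (ε : ℝ) (x : E n) :
    LpOn Ω 2 :=
  haveI := isFiniteMeasure_of_bounded hb
  indicatorConstLp 2 (measurableSet_closedBall (x := x) (ε := ε))
    (measure_ne_top (volume.restrict Ω) _) (1 : ℝ)

theorem norm_ballInd_sq_le {n : ℕ} {Ω : Set (E n)} (hb : Bornology.IsBounded Ω) (ε : ℝ)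
    (x : E n) : ‖ballInd hb ε x‖ ^ 2 ≤ volume.real (Metric.closedBall (0 : E n) ε) := by
  rw [ballInd, norm_indicatorConstLp (by norm_num) (by norm_num)]
  rw [norm_one, one_mul, ← Real.rpow_natCast, ← Real.rpow_mul measureReal_nonneg]
  norm_num
  rw [measureReal_def, measureReal_def, ← Measure.addHaar_closedBall_center volume x]
  exact ENNReal.toReal_mono measure_closedBall_lt_top.ne
    (Measure.restrict_apply_le _ _)

theorem norm_sq_eq_lintegral {α : Type*} [MeasurableSpace α] {μ : Measure α} (u : Lp ℝ 2 μ) :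
    ENNReal.ofReal (‖u‖ ^ 2) = ∫⁻ x, ‖u x‖ₑ ^ 2 ∂μ := by
  have := eLpNorm_nnreal_pow_eq_lintegral (f := u) (μ := μ) (p := 2) (by norm_num)
  rw [ENNReal.ofReal_pow (norm_nonneg _), Lp.norm_def, ENNReal.ofReal_toReal (Lp.eLpNorm_ne_top u)]
  simpa using this

/-- Cauchy–Schwarz in coordinates. It passes from the operator norm in the translation estimate to
the partial derivatives recorded in `testJets`. -/
theorem enorm_fderiv_sq_le {n : ℕ} (φ : E n → ℝ) (x : E n) :
    ‖fderiv ℝ φ x‖ₑ ^ 2 ≤ ∑ i, ‖partialDeriv i φ x‖ₑ ^ 2 := by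
  have h : ‖fderiv ℝ φ x‖ ^ 2 ≤ ∑ i, ‖partialDeriv i φ x‖ ^ 2 := by
    have hs : 0 ≤ ∑ i, ‖partialDeriv i φ x‖ ^ 2 := Finset.sum_nonneg fun i _ => sq_nonneg _
    rw [← Real.sqrt_le_sqrt_iff hs, Real.sqrt_sq (norm_nonneg _)]
    refine ContinuousLinearMap.opNorm_le_bound _ (Real.sqrt_nonneg _) fun v => ?_
    have hv : v = ∑ i, v i • EuclideanSpace.single i (1 : ℝ) := by
      ext j; simp [Finset.sum_apply, Pi.single_apply]
    have e : fderiv ℝ φ x v = ∑ i, partialDeriv i φ x * v i := by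
      conv_lhs => rw [hv]
      rw [map_sum]
      refine Finset.sum_congr rfl fun i _ => ?_
      rw [map_smul, smul_eq_mul, mul_comm, partialDeriv]
    rw [e, EuclideanSpace.norm_eq, ← Real.sqrt_mul hs, Real.norm_eq_abs]
    refine Real.abs_le_sqrt ?_
    simpa using Finset.sum_mul_sq_le_sq_mul_sq Finset.univ (fun i => partialDeriv i φ x) v
  have := ENNReal.ofReal_le_ofReal h
  rw [ENNReal.ofReal_sum_of_nonneg fun i _ => sq_nonneg _] at this
  simpa only [ENNReal.ofReal_pow (norm_nonneg _), ofReal_norm] using this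

/-- As `φ` vanishes outside `Ω`, cutting the ball down to `Ω` loses nothing. The inner product form
is what makes Bessel's inequality applicable at each `x`. -/
theorem average_eq_inner_ballInd {n : ℕ} {Ω : Set (E n)} (hb : Bornology.IsBounded Ω)
    {φ : E n → ℝ} (hs : tsupport φ ⊆ Ω) {u : LpOn Ω 2} (hu : u =ᵐ[volume.restrict Ω] φ)
    (ε : ℝ) (x : E n) :
    ∫ y in Metric.closedBall 0 ε, φ (x + y) = inner ℝ (ballInd hb ε x) u := by
  rw [ballInd, L2.inner_indicatorConstLp_one, integral_congr_ae (ae_restrict_of_ae hu),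
    Measure.restrict_restrict measurableSet_closedBall]
  have h1 : ∫ y in Metric.closedBall x ε ∩ Ω, φ y = ∫ y in Metric.closedBall x ε, φ y := by
    refine (setIntegral_eq_of_subset_of_forall_sdiff_eq_zero measurableSet_closedBall
      inter_subset_left fun y hy => ?_).symm
    exact image_eq_zero_of_notMem_tsupport fun h => hy.2 ⟨hy.1, hs h⟩
  rw [h1, ← integral_indicator measurableSet_closedBall, ← integral_indicator
    measurableSet_closedBall, ← integral_add_left_eq_self ((Metric.closedBall x ε).indicator φ) x]
  refine integral_congr_ae (Eventually.of_forall fun y => ?_)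
  have hm : y ∈ Metric.closedBall (0 : E n) ε ↔ x + y ∈ Metric.closedBall x ε := by simp
  by_cases hy : y ∈ Metric.closedBall (0 : E n) ε
  · exact (indicator_of_mem hy _).trans (indicator_of_mem (hm.1 hy) _).symm
  · exact (indicator_of_notMem hy _).trans (indicator_of_notMem (mt hm.2 hy) _).symm

/-- Test functions are close in `L²` to their averages over small balls. -/
theorem norm_sq_le_of_mem_testJets {n : ℕ} {Ω : Set (E n)} (hb : Bornology.IsBounded Ω)
    {q : LpOn Ω 2 × (Fin n → LpOn Ω 2)} (hq : q ∈ testJets Ω 2) {ε : ℝ} (hε : 0 < ε) :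
    ENNReal.ofReal (‖q.1‖ ^ 2) ≤
      2 * (∫⁻ x in Ω, ENNReal.ofReal
        (((volume.real (Metric.closedBall (0 : E n) ε))⁻¹ *
          inner ℝ (ballInd hb ε x) q.1) ^ 2))
      + 2 * (ENNReal.ofReal (ε ^ 2) * ENNReal.ofReal (∑ i, ‖q.2 i‖ ^ 2)) := by
  obtain ⟨φ, hφ, h1, h2⟩ := hq
  have hφ1 : ContDiff ℝ 1 φ := hφ.1.of_le (by exact_mod_cast le_top)
  set V := volume.real (Metric.closedBall (0 : E n) ε)
  have hV0 : volume (Metric.closedBall (0 : E n) ε) ≠ 0 :=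
    (Metric.measure_closedBall_pos _ _ hε).ne'
  have hVt : volume (Metric.closedBall (0 : E n) ε) ≠ ⊤ := measure_closedBall_lt_top.ne
  let μ : Measure (E n) := (volume (Metric.closedBall (0 : E n) ε))⁻¹ •
    volume.restrict (Metric.closedBall (0 : E n) ε)
  have : IsProbabilityMeasure μ := ⟨by simp [μ, ENNReal.inv_mul_cancel hV0 hVt]⟩
  have hμ : ∀ᵐ y ∂μ, ‖y‖ ≤ ε := by
    refine Measure.ae_smul_measure ?_ _
    filter_upwards [ae_restrict_mem measurableSet_closedBall] with y hy
    simpa using hy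
  have hT : ∀ x, ∫ y, φ (x + y) ∂μ = V⁻¹ * inner ℝ (ballInd hb ε x) q.1 := by
    intro x
    rw [integral_smul_measure, average_eq_inner_ballInd hb hφ.2.2 h1]
    simp [V, measureReal_def]
  have hA := lintegral_average_sub_sq_le hφ1 hφ.2.1 hμ
  simp only [hT] at hA
  have hD : ∫⁻ x, ‖fderiv ℝ φ x‖ₑ ^ 2 ≤ ENNReal.ofReal (∑ i, ‖q.2 i‖ ^ 2) := by
    have hz : ∫⁻ x, ‖fderiv ℝ φ x‖ₑ ^ 2 = ∫⁻ x in Ω, ‖fderiv ℝ φ x‖ₑ ^ 2 := by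
      refine (setLIntegral_eq_of_support_subset ?_).symm
      intro x hx
      refine hφ.2.2 (support_fderiv_subset ℝ fun h => hx ?_)
      change ‖fderiv ℝ φ x‖ₑ ^ 2 = 0
      rw [← ofReal_norm, h, norm_zero]
      simp
    rw [hz, ENNReal.ofReal_sum_of_nonneg fun i _ => sq_nonneg _]
    refine (lintegral_mono fun x => enorm_fderiv_sq_le φ x).trans_eq ?_
    rw [lintegral_finsetSum _ fun i _ =>
      (partialDeriv_continuous hφ1 i).measurable.enorm.pow_const 2]
    refine Finset.sum_congr rfl fun i _ => ?_
    rw [norm_sq_eq_lintegral]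
    refine lintegral_congr_ae ?_
    filter_upwards [h2 i] with x hx
    rw [hx]
  -- Measurability in `x`, needed to split the integral below, is read off from the average of `φ (x
  -- + y)` over `y`.
  have hmeas : Measurable fun x => V⁻¹ * inner ℝ (ballInd hb ε x) q.1 := by
    simp only [← hT]
    have : Continuous fun p : E n × E n => φ (p.1 + p.2) := hφ1.continuous.comp (by fun_prop)
    exact (StronglyMeasurable.integral_prod_right (ν := μ)
      (f := fun x y => φ (x + y)) this.stronglyMeasurable).measurable
  rw [norm_sq_eq_lintegral]
  calc ∫⁻ x in Ω, ‖q.1 x‖ₑ ^ 2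
      ≤ ∫⁻ x in Ω, (2 * ENNReal.ofReal ((V⁻¹ * inner ℝ (ballInd hb ε x) q.1) ^ 2)
        + 2 * ‖V⁻¹ * inner ℝ (ballInd hb ε x) q.1 - φ x‖ₑ ^ 2) := by
        refine lintegral_mono_ae ?_
        filter_upwards [h1] with x hx
        rw [hx]
        generalize V⁻¹ * inner ℝ (ballInd hb ε x) q.1 = t
        rw [← ofReal_norm, ← ofReal_norm, ← ENNReal.ofReal_pow (norm_nonneg _),
          ← ENNReal.ofReal_pow (norm_nonneg _), ← ENNReal.ofReal_ofNat 2,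
          ← ENNReal.ofReal_mul (by norm_num), ← ENNReal.ofReal_mul (by norm_num),
          ← ENNReal.ofReal_add (by positivity) (by positivity)]
        refine ENNReal.ofReal_le_ofReal ?_
        simp only [Real.norm_eq_abs, sq_abs]
        -- With `s = φ x`: `2 t² + 2 (t - s)² - s² = (2 t - s)²`.
        nlinarith [sq_nonneg (2 * t - φ x)]
    _ = 2 * (∫⁻ x in Ω, ENNReal.ofReal ((V⁻¹ * inner ℝ (ballInd hb ε x) q.1) ^ 2))
        + 2 * ∫⁻ x in Ω, ‖V⁻¹ * inner ℝ (ballInd hb ε x) q.1 - φ x‖ₑ ^ 2 := by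
        rw [lintegral_add_left ((hmeas.pow_const 2).ennreal_ofReal.const_mul 2),
          lintegral_const_mul' _ _ (by norm_num), lintegral_const_mul' _ _ (by norm_num)]
    _ ≤ _ := by
        gcongr
        refine (setLIntegral_le_lintegral _ _).trans (hA.trans ?_)
        rw [ENNReal.ofReal_pow hε.le]
        gcongr

/-! ### A quantitative Rellich theorem -/

/-- The lower integral is superadditive, so this direction needs no measurability. -/
theorem sum_lintegral_le_lintegral_sum {α ι : Type*} [MeasurableSpace α] {μ : Measure α}
    (s : Finset ι) (f : ι → α → ℝ≥0∞) :
    ∑ i ∈ s, ∫⁻ x, f i x ∂μ ≤ ∫⁻ x, ∑ i ∈ s, f i x ∂μ := by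
  classical
  induction s using Finset.induction_on with
  | empty => simp
  | insert i s hi ih =>
    simp only [Finset.sum_insert hi]
    exact (add_le_add_right ih _).trans (le_lintegral_add _ _)

theorem add_sq_le_two_mul (a b : ℝ) : (a + b) ^ 2 ≤ 2 * a ^ 2 + 2 * b ^ 2 := by
  nlinarith [sq_nonneg (a - b)]

/-- An orthonormal family in `L²(Ω)` that is bounded in `W_0^{1,2}(Ω)` has a bounded number of
elements. -/
theorem card_le_of_orthonormal {n : ℕ} {Ω : Set (E n)}
    (hb : Bornology.IsBounded Ω) {C ε : ℝ} (hε : 0 < ε)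
    (hεC : ε ^ 2 * (2 * C + 2 * n) ≤ 1 / 8) {N : ℕ} {e : Fin N → LpOn Ω 2}
    (he : Orthonormal ℝ e)
    (hg : ∀ k, ∃ g : Fin n → LpOn Ω 2, (e k, g) ∈ (testJets Ω 2).topologicalClosure ∧
      ∑ i, ‖g i‖ ^ 2 ≤ C) :
    (N : ℝ) ≤ 32 * volume.real Ω / volume.real (Metric.closedBall (0 : E n) ε) := by
  have hfin := isFiniteMeasure_of_bounded hb
  set V := volume.real (Metric.closedBall (0 : E n) ε) with hVdef
  have hV : 0 < V := ENNReal.toReal_pos (Metric.measure_closedBall_pos _ _ hε).ne'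
    measure_closedBall_lt_top.ne
  -- `η` is the error in replacing each `e k` by a test function. It may depend on `N`, since it
  -- drops out of the final bound: `η ≤ 1/4` keeps the norms at least `3/4`, and `N η² ≤ 1` controls
  -- the total error in Bessel's inequality.
  obtain ⟨η, hη0, hη1, hη2⟩ : ∃ η : ℝ, 0 < η ∧ η ≤ 1 / 4 ∧ N * η ^ 2 ≤ 1 := by
    refine ⟨1 / (4 * (N + 1)), by positivity, ?_, ?_⟩
    · rw [div_le_div_iff₀ (by positivity) (by norm_num)]
      linarith [(Nat.cast_nonneg N : (0 : ℝ) ≤ N)]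
    · rw [div_pow, one_pow, mul_one_div, div_le_one (by positivity)]
      nlinarith [(Nat.cast_nonneg N : (0 : ℝ) ≤ N)]
  have hq : ∀ k, ∃ q ∈ testJets Ω 2, ‖q.1 - e k‖ ≤ η ∧ ∑ i, ‖q.2 i‖ ^ 2 ≤ 2 * C + 2 * n := by
    intro k
    obtain ⟨g, hg1, hg2⟩ := hg k
    obtain ⟨q, hq, hd⟩ := Metric.mem_closure_iff.1 hg1 η hη0
    rw [dist_comm, dist_eq_norm] at hd
    have h1 : ‖q.1 - e k‖ ≤ η := (norm_fst_le (q - (e k, g))).trans hd.le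
    have h2 : ∀ i, ‖q.2 i - g i‖ ≤ η := fun i =>
      ((norm_le_pi_norm (q.2 - g) i).trans (norm_snd_le (q - (e k, g)))).trans hd.le
    refine ⟨q, hq, h1, ?_⟩
    have h3 : ∀ i, ‖q.2 i‖ ^ 2 ≤ 2 * ‖g i‖ ^ 2 + 2 := fun i => by
      have h4 : ‖q.2 i‖ ≤ ‖g i‖ + ‖q.2 i - g i‖ := by
        simpa using norm_add_le (g i) (q.2 i - g i)
      have h5 : ‖q.2 i - g i‖ ^ 2 ≤ 1 :=
        (sq_le_one_iff₀ (norm_nonneg _)).2 ((h2 i).trans (by linarith))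
      have := pow_le_pow_left₀ (norm_nonneg _) h4 2
      linarith [add_sq_le_two_mul ‖g i‖ ‖q.2 i - g i‖]
    refine (Finset.sum_le_sum fun i _ => h3 i).trans ?_
    rw [Finset.sum_add_distrib, ← Finset.mul_sum, Finset.sum_const, Finset.card_univ,
      Fintype.card_fin, nsmul_eq_mul]
    linarith
  choose q hqt hqe hqg using hq
  let I : Fin N → ℝ≥0∞ := fun k =>
    ∫⁻ x in Ω, ENNReal.ofReal ((V⁻¹ * inner ℝ (ballInd hb ε x) (q k).1) ^ 2)
  -- Lower bound for the averages: `1/2 ≤ ‖q‖² ≤ 2 I + 1/4`, the gradient term being at most `1/4`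
  -- by the choice of `ε`.
  have hI : ∀ k, ENNReal.ofReal (1 / 4) ≤ 2 * I k := by
    intro k
    have h1 := norm_sq_le_of_mem_testJets hb (hqt k) hε
    have h2 : (1 : ℝ) / 2 ≤ ‖(q k).1‖ ^ 2 := by
      have h4 : ‖e k‖ ≤ ‖(q k).1‖ + ‖(q k).1 - e k‖ := norm_le_norm_add_norm_sub _ _
      rw [he.1 k] at h4
      nlinarith [hqe k]
    have h3 : 2 * (ENNReal.ofReal (ε ^ 2) * ENNReal.ofReal (∑ i, ‖(q k).2 i‖ ^ 2))
        ≤ ENNReal.ofReal (1 / 4) := by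
      have h2' : (2 : ℝ≥0∞) = ENNReal.ofReal 2 := by simp
      rw [← ENNReal.ofReal_mul (by positivity)]
      refine (congrArg (· * _) h2').trans_le ?_
      rw [← ENNReal.ofReal_mul (by norm_num)]
      refine ENNReal.ofReal_le_ofReal ?_
      have := mul_le_mul_of_nonneg_left (hqg k) (sq_nonneg ε)
      linarith
    refine (ENNReal.add_le_add_iff_right (ENNReal.ofReal_ne_top (r := 1 / 4))).1 ?_
    rw [← ENNReal.ofReal_add (by norm_num) (by norm_num)]
    refine le_trans (ENNReal.ofReal_le_ofReal ?_) (h1.trans (add_le_add_right h3 _))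
    linarith
  -- Bessel's inequality at a fixed `x`: the `e k` contribute at most `2 ‖K‖² ≤ 2 V` and the
  -- approximation errors at most `2 V N η² ≤ 2 V`.
  have hpt : ∀ x, ∑ k, ENNReal.ofReal ((V⁻¹ * inner ℝ (ballInd hb ε x) (q k).1) ^ 2)
      ≤ ENNReal.ofReal (4 / V) := by
    intro x
    rw [← ENNReal.ofReal_sum_of_nonneg fun k _ => sq_nonneg _]
    refine ENNReal.ofReal_le_ofReal ?_
    set K := ballInd hb ε x
    have hK : ‖K‖ ^ 2 ≤ V := norm_ballInd_sq_le hb ε x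
    have h1 : ∀ k, (V⁻¹ * inner ℝ K (q k).1) ^ 2
        ≤ V⁻¹ ^ 2 * (2 * ‖inner ℝ (e k) K‖ ^ 2 + 2 * (V * η ^ 2)) := by
      intro k
      rw [mul_pow]
      refine mul_le_mul_of_nonneg_left ?_ (sq_nonneg _)
      have e1 : inner ℝ K (q k).1 = inner ℝ (e k) K + inner ℝ K ((q k).1 - e k) := by
        rw [real_inner_comm K (e k), ← inner_add_right]; simp
      have e2 : (inner ℝ K ((q k).1 - e k)) ^ 2 ≤ V * η ^ 2 := by
        rw [← sq_abs]
        refine (pow_le_pow_left₀ (abs_nonneg _) (abs_real_inner_le_norm _ _) 2).trans ?_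
        rw [mul_pow]
        exact mul_le_mul hK (pow_le_pow_left₀ (norm_nonneg _) (hqe k) 2) (sq_nonneg _) hV.le
      rw [e1, Real.norm_eq_abs, sq_abs]
      exact (add_sq_le_two_mul _ _).trans (by linarith)
    refine (Finset.sum_le_sum fun k _ => h1 k).trans ?_
    rw [← Finset.mul_sum, Finset.sum_add_distrib, ← Finset.mul_sum, Finset.sum_const,
      Finset.card_univ, Fintype.card_fin, nsmul_eq_mul]
    have h2 := (he.sum_inner_products_le K (s := Finset.univ)).trans hK
    have h3 : 2 * ∑ k, ‖inner ℝ (e k) K‖ ^ 2 + N * (2 * (V * η ^ 2)) ≤ 4 * V := by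
      nlinarith [mul_le_mul_of_nonneg_left hη2 hV.le]
    refine (mul_le_mul_of_nonneg_left h3 (sq_nonneg _)).trans_eq ?_
    field_simp
  -- Integrate the pointwise bound over `Ω` and compare with the `N` lower bounds.
  have hsum : (N : ℝ) * (1 / 4) ≤ 2 * (4 / V * volume.real Ω) := by
    have h1 : ENNReal.ofReal (N * (1 / 4)) ≤ ENNReal.ofReal (2 * (4 / V * volume.real Ω)) := by
      rw [ENNReal.ofReal_mul (Nat.cast_nonneg _), ENNReal.ofReal_natCast,
        ENNReal.ofReal_mul (by norm_num), ENNReal.ofReal_mul (by positivity), measureReal_def,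
        ENNReal.ofReal_toReal hb.measure_lt_top.ne, ENNReal.ofReal_ofNat]
      calc (N : ℝ≥0∞) * ENNReal.ofReal (1 / 4) = ∑ _k : Fin N, ENNReal.ofReal (1 / 4) := by simp
        _ ≤ ∑ k, 2 * I k := Finset.sum_le_sum fun k _ => hI k
        _ = 2 * ∑ k, I k := by rw [Finset.mul_sum]
        _ ≤ 2 * ∫⁻ _x in Ω, ENNReal.ofReal (4 / V) := by
            gcongr
            exact (sum_lintegral_le_lintegral_sum _ _).trans (lintegral_mono hpt)
        _ = _ := by rw [setLIntegral_const]
    exact (ENNReal.ofReal_le_ofReal_iff (by positivity)).1 h1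
  rw [le_div_iff₀ hV]
  have := mul_le_mul_of_nonneg_right hsum hV.le
  field_simp at this
  linarith

/-- A subspace of `W_0^{1,2}(Ω)` on which the Dirichlet integral is controlled by the `L²` norm is
finite-dimensional. -/
theorem finiteDimensional_of_gradient_le {n : ℕ} {Ω : Set (E n)}
    (hb : Bornology.IsBounded Ω) {C : ℝ} (hC : 0 ≤ C) {W : Submodule ℝ (LpOn Ω 2)}
    (hW : ∀ u ∈ W, ∃ g : Fin n → LpOn Ω 2, (u, g) ∈ (testJets Ω 2).topologicalClosure ∧
      ∑ i, ‖g i‖ ^ 2 ≤ C * ‖u‖ ^ 2) : FiniteDimensional ℝ W := by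
  obtain ⟨ε, hε, hεC⟩ : ∃ ε : ℝ, 0 < ε ∧ ε ^ 2 * (2 * C + 2 * n) ≤ 1 / 8 := by
    refine ⟨(4 * (2 * C + 2 * n + 1))⁻¹, by positivity, ?_⟩
    have hn : (0 : ℝ) ≤ n := Nat.cast_nonneg n
    rw [inv_pow, inv_mul_le_iff₀ (by positivity)]
    nlinarith
  have key : Module.rank ℝ W ≤
      (⌊32 * volume.real Ω / volume.real (Metric.closedBall (0 : E n) ε)⌋₊ : ℕ) := by
    -- A linearly independent set of `N` vectors spans a space with an orthonormal basis of `N`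
    -- vectors. On unit vectors the gradient bound is just `C`, so the previous bound on `N`
    -- applies.
    refine rank_le fun s hs => Nat.le_floor ?_
    have hc : Module.finrank ℝ (Submodule.span ℝ (s : Set W)) = s.card :=
      finrank_span_finset_eq_card hs
    have b := stdOrthonormalBasis ℝ (Submodule.span ℝ (s : Set W))
    rw [hc] at b
    have he : Orthonormal ℝ fun k => ((b k : W) : LpOn Ω 2) :=
      (b.orthonormal.comp_linearIsometry (Submodule.subtypeₗᵢ _)).comp_linearIsometry
        (Submodule.subtypeₗᵢ W)
    refine card_le_of_orthonormal hb hε hεC he fun k => ?_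
    obtain ⟨g, h1, h2⟩ := hW _ (b k : W).2
    refine ⟨g, h1, h2.trans_eq ?_⟩
    rw [he.1 k]; ring
  exact Module.rank_lt_aleph0_iff.1 (key.trans_lt (Cardinal.natCast_lt_aleph0))

/-! ### The energy estimate -/

theorem coeFn_toL2 {n : ℕ} {Ω : Set (E n)} (hb : Bornology.IsBounded Ω) {p : ℝ≥0∞} (hp : 2 ≤ p)
    (u : LpOn Ω p) : toL2 hb hp u =ᵐ[volume.restrict Ω] u :=
  haveI := isFiniteMeasure_of_bounded hb
  MemLp.coeFn_toLp ((Lp.memLp u).mono_exponent hp)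

theorem toL2_injective {n : ℕ} {Ω : Set (E n)} (hb : Bornology.IsBounded Ω) {p : ℝ≥0∞}
    (hp : 2 ≤ p) : Function.Injective (toL2 hb hp) := fun u v h =>
  Lp.ext ((coeFn_toL2 hb hp u).symm.trans (h ▸ coeFn_toL2 hb hp v))

theorem exists_norm_toL2_le {n : ℕ} {Ω : Set (E n)} (hb : Bornology.IsBounded Ω) {p : ℝ≥0∞}
    (hp : 2 ≤ p) : ∃ C : ℝ, 0 ≤ C ∧ ∀ u : LpOn Ω p, ‖toL2 hb hp u‖ ≤ C * ‖u‖ := by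
  have := isFiniteMeasure_of_bounded hb
  set c : ℝ≥0∞ := (volume.restrict Ω) univ ^ (1 / (2 : ℝ≥0∞).toReal - 1 / p.toReal)
  have hc : c ≠ ⊤ := by
    refine ENNReal.rpow_ne_top_of_nonneg ?_ (measure_ne_top _ _)
    -- For `p = ⊤` both `toReal` and division by zero give `0`, so the exponent is `1/2`, as it
    -- should be.
    by_cases h : p = ⊤
    · simp [h]
    · rw [sub_nonneg]
      exact one_div_le_one_div_of_le (by norm_num) (ENNReal.toReal_mono h hp)
  refine ⟨c.toReal, ENNReal.toReal_nonneg, fun u => ?_⟩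
  have h := eLpNorm_le_eLpNorm_mul_rpow_measure_univ hp (Lp.aestronglyMeasurable u)
  rw [← ENNReal.toReal_le_toReal] at h
  · rw [ENNReal.toReal_mul, mul_comm] at h
    exact (Lp.norm_toLp _ ((Lp.memLp u).mono_exponent hp)).trans_le h
  · exact ((Lp.memLp u).mono_exponent hp).2.ne
  · exact ENNReal.mul_ne_top (Lp.eLpNorm_ne_top u) hc

theorem continuous_toL2 {n : ℕ} {Ω : Set (E n)} (hb : Bornology.IsBounded Ω) {p : ℝ≥0∞}
    [Fact (1 ≤ p)] (hp : 2 ≤ p) : Continuous (toL2 hb hp) := by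
  obtain ⟨C, -, hC⟩ := exists_norm_toL2_le hb hp
  exact ((toL2 hb hp).mkContinuous C hC).continuous

theorem innerL2_eq {n : ℕ} {Ω : Set (E n)} (hb : Bornology.IsBounded Ω) {p : ℝ≥0∞}
    (hp : 2 ≤ p) (u v : LpOn Ω p) : innerL2 hb hp u v = ∫ x in Ω, u x * v x := by
  rw [innerL2, L2.inner_def]
  refine integral_congr_ae ?_
  filter_upwards [coeFn_toL2 hb hp u, coeFn_toL2 hb hp v] with x hu hv
  rw [hu, hv]
  simp [mul_comm]

/-- Integration by parts against `W_0^{1,p}(Ω)`. -/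
theorem innerL2_weakPartial {n : ℕ} {Ω : Set (E n)} (hb : Bornology.IsBounded Ω) {p : ℝ≥0∞}
    [Fact (1 ≤ p)] (hp : 2 ≤ p) {w : LpOn Ω p} (hw : w ∈ W1 hb p) (j : Fin n)
    {q : LpOn Ω p × (Fin n → LpOn Ω p)} (hq : q ∈ (testJets Ω p).topologicalClosure) :
    innerL2 hb hp w (q.2 j) = - innerL2 hb hp (weakPartial Ω j w) q.1 := by
  have hcont := continuous_toL2 hb hp
  -- Both sides are continuous in the jet, and for jets of test functions the identity is the
  -- definition of the weak derivative.
  have hcl : IsClosed {q : LpOn Ω p × (Fin n → LpOn Ω p) |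
      innerL2 hb hp w (q.2 j) = - innerL2 hb hp (weakPartial Ω j w) q.1} := by
    unfold innerL2
    exact isClosed_eq (continuous_const.inner (hcont.comp (by fun_prop)))
      (continuous_const.inner (hcont.comp (by fun_prop))).neg
  refine closure_minimal (fun r hr => ?_) hcl hq
  obtain ⟨φ, hφ, h1, h2⟩ := hr
  simp only [mem_ofPred_eq, innerL2_eq]
  rw [integral_congr_ae (g := fun x => w x * partialDeriv j φ x)
      (by filter_upwards [h2 j] with x hx; rw [hx]),
    integral_congr_ae (f := fun x => weakPartial Ω j w x * r.1 x)
      (g := fun x => weakPartial Ω j w x * φ x) (by filter_upwards [h1] with x hx; rw [hx])]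
  exact weakPartial_spec (hw j) φ hφ

/-- The embedding is continuous and maps test jets to test jets. It moves `W_0^{1,p}` into the
Hilbert space setting of the counting argument. -/
theorem toL2_mem_closure_testJets {n : ℕ} {Ω : Set (E n)} (hb : Bornology.IsBounded Ω) {p : ℝ≥0∞}
    [Fact (1 ≤ p)] (hp : 2 ≤ p) {q : LpOn Ω p × (Fin n → LpOn Ω p)}
    (hq : q ∈ (testJets Ω p).topologicalClosure) :
    (toL2 hb hp q.1, fun i => toL2 hb hp (q.2 i)) ∈ (testJets Ω 2).topologicalClosure := by
  have hcont := continuous_toL2 hb hp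
  have hc : Continuous fun q : LpOn Ω p × (Fin n → LpOn Ω p) =>
      (toL2 hb hp q.1, fun i => toL2 hb hp (q.2 i)) :=
    (hcont.comp continuous_fst).prodMk (continuous_pi fun i =>
      hcont.comp ((continuous_apply i).comp continuous_snd))
  refine map_mem_closure (s := (testJets Ω p : Set _)) (t := (testJets Ω 2 : Set _)) hc hq
    fun r hr => ?_
  obtain ⟨φ, hφ, h1, h2⟩ := hr
  exact ⟨φ, hφ, (coeFn_toL2 hb hp _).trans h1, fun i => (coeFn_toL2 hb hp _).trans (h2 i)⟩

theorem norm_toL2_sq {n : ℕ} {Ω : Set (E n)} (hb : Bornology.IsBounded Ω) {p : ℝ≥0∞}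
    (hp : 2 ≤ p) (u : LpOn Ω p) : ‖toL2 hb hp u‖ ^ 2 = ∫ x in Ω, u x ^ 2 := by
  rw [← real_inner_self_eq_norm_sq]
  exact (innerL2_eq hb hp u u).trans (by simp only [sq])

theorem integrable_mul {n : ℕ} {Ω : Set (E n)} (hb : Bornology.IsBounded Ω) {p : ℝ≥0∞}
    (hp : 2 ≤ p) (u v : LpOn Ω p) : Integrable (fun x => u x * v x) (volume.restrict Ω) := by
  have := isFiniteMeasure_of_bounded hb
  exact ((Lp.memLp u).mono_exponent hp).integrable_mul ((Lp.memLp v).mono_exponent hp)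

/-- The energy estimate for eigenfunctions. -/
theorem exists_gradient_le_of_mem_eigenspace {n : ℕ} {Ω : Set (E n)} (hΩ : IsOpen Ω)
    (hb : Bornology.IsBounded Ω) {a : Fin n → Fin n → E n → ℝ} (ha : IsEllipticCoeff Ω a)
    {p : ℝ≥0∞} [Fact (1 ≤ p)] (hp : 2 ≤ p) (lam : ℝ) :
    ∃ C : ℝ, 0 ≤ C ∧ ∀ u ∈ eigenspace (ellipticOp hΩ hb ha p) lam,
      ∃ g : Fin n → LpOn Ω 2, (toL2 hb hp u, g) ∈ (testJets Ω 2).topologicalClosure ∧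
        ∑ i, ‖g i‖ ^ 2 ≤ C * ‖toL2 hb hp u‖ ^ 2 := by
  obtain ⟨c, hc, hell⟩ := ha.elliptic
  refine ⟨|lam| / c, by positivity, fun u hu => ?_⟩
  have hu' : (u, lam • u) ∈ (ellipticOp hΩ hb ha p).graph := hu
  obtain ⟨⟨u', hud⟩, h1, h2⟩ := LinearPMap.mem_graph_iff _ |>.1 hu'
  obtain rfl : u' = u := h1
  set D : Fin n → LpOn Ω p := fun i => weakPartial Ω i u' with hD
  have hjet : (u', D) ∈ (testJets Ω p).topologicalClosure := hud.2.2
  refine ⟨fun i => toL2 hb hp (D i), toL2_mem_closure_testJets hb hp hjet, ?_⟩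
  have h3 : - ∑ i, ∑ j, weakPartial Ω j (mulC1 hΩ hb p (ha.smooth i j) (D i)) = lam • u' := h2
  -- The weak form of the equation: pair it with `u'` itself and integrate by parts, using that `u'`
  -- lies in `W_0^{1,p}`.
  have h4 : ∑ i, ∑ j, innerL2 hb hp (mulC1 hΩ hb p (ha.smooth i j) (D i)) (D j)
      = lam * ‖toL2 hb hp u'‖ ^ 2 := by
    rw [← real_inner_self_eq_norm_sq, ← real_inner_smul_left, ← map_smul, ← h3, map_neg,
      inner_neg_left, map_sum, sum_inner, ← Finset.sum_neg_distrib]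
    refine Finset.sum_congr rfl fun i _ => ?_
    rw [map_sum, sum_inner, ← Finset.sum_neg_distrib]
    refine Finset.sum_congr rfl fun j _ => ?_
    exact innerL2_weakPartial hb hp (mulC1_mem_W1 hΩ hb _ (hud.1.2 i)) j hjet
  -- Ellipticity at almost every `x` with `ξ = ∇u'(x)`, integrated over `Ω`.
  have h5 : c * ∑ i, ‖toL2 hb hp (D i)‖ ^ 2 ≤
      ∑ i, ∑ j, innerL2 hb hp (mulC1 hΩ hb p (ha.smooth i j) (D i)) (D j) := by
    simp only [innerL2_eq, norm_toL2_sq]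
    have i1 : ∀ i, Integrable (fun x => D i x ^ 2) (volume.restrict Ω) := fun i => by
      simpa only [sq] using integrable_mul hb hp (D i) (D i)
    have i2 := fun i j => integrable_mul hb hp (mulC1 hΩ hb p (ha.smooth i j) (D i)) (D j)
    rw [← integral_finsetSum _ fun i _ => i1 i, ← integral_const_mul]
    simp only [← integral_finsetSum _ fun j _ => i2 _ j]
    rw [← integral_finsetSum _ fun i _ => integrable_finsetSum _ fun j _ => i2 i j]
    refine integral_mono_ae ((integrable_finsetSum _ fun i _ => i1 i).const_mul c)
      (integrable_finsetSum _ fun i _ => integrable_finsetSum _ fun j _ => i2 i j) ?_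
    have hm : ∀ᵐ x ∂volume.restrict Ω, ∀ i j,
        mulC1 hΩ hb p (ha.smooth i j) (D i) x = a i j x * D i x :=
      ae_all_iff.2 fun i => ae_all_iff.2 fun j =>
          MemLp.coeFn_toLp ((ha.smooth i j).memLp_mul hΩ hb (D i))
    filter_upwards [hm, ae_restrict_mem hΩ.measurableSet] with x hx hxΩ
    have := hell x hxΩ (WithLp.toLp 2 fun i => D i x)
    simpa [hx, EuclideanSpace.norm_sq_eq] using this
  rw [div_mul_eq_mul_div, le_div_iff₀ hc, mul_comm]
  refine h5.trans (h4.le.trans ?_)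
  exact mul_le_mul_of_nonneg_right (le_abs_self _) (sq_nonneg _)

theorem finiteDimensional_map_eigenspace {n : ℕ} {Ω : Set (E n)} (hΩ : IsOpen Ω)
    (hb : Bornology.IsBounded Ω) {a : Fin n → Fin n → E n → ℝ} (ha : IsEllipticCoeff Ω a)
    {p : ℝ≥0∞} [Fact (1 ≤ p)] (hp : 2 ≤ p) (lam : ℝ) :
    FiniteDimensional ℝ ((eigenspace (ellipticOp hΩ hb ha p) lam).map (toL2 hb hp)) := by
  obtain ⟨C, hC, h⟩ := exists_gradient_le_of_mem_eigenspace hΩ hb ha hp lam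
  refine finiteDimensional_of_gradient_le hb hC ?_
  rintro _ ⟨u, hu, rfl⟩
  exact h u hu

/-! ### From the fractional norm to the norm of `L^p` -/

/-- On its range `fracInv` has `fracPow` as a right inverse, so `z = A^{-α} (A^α z)` and boundedness
of `fracInv` suffices. This covers the default value `0` as well. -/
theorem exists_norm_le_of_fracNorm_le {X : Type*} [NormedAddCommGroup X] [NormedSpace ℝ X]
    (A : X →ₗ.[ℝ] X) (α : ℝ) {B : Set X} (hB : B ⊆ fracSpace A α)
    (hM : ∃ M : ℝ, ∀ z ∈ B, fracNorm A α z ≤ M) : ∃ M : ℝ, ∀ z ∈ B, ‖z‖ ≤ M := by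
  obtain ⟨M, hM⟩ := hM
  refine ⟨‖fracInv A α‖ * M, fun z hz => ?_⟩
  have h : fracInv A α (fracPow A α z) = z := Function.invFun_eq (hB hz)
  rw [← h]
  exact ((fracInv A α).le_opNorm _).trans
    (mul_le_mul_of_nonneg_left (hM z hz) (norm_nonneg _))

theorem alphaSpace_le_fracSpace {n : ℕ} {Ω : Set (E n)} (hb : Bornology.IsBounded Ω) {p : ℝ≥0∞}
    [Fact (1 ≤ p)] (hp : 2 ≤ p) (A : LpOn Ω p →ₗ.[ℝ] LpOn Ω p) (α μ : ℝ) :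
    alphaSpace hb hp A α μ ≤ fracSpace A α :=
  sup_le inf_le_left inf_le_left

/-! ### Asymptotics of the Nemitskii operator -/

theorem innerL2_add_right {n : ℕ} {Ω : Set (E n)} (hb : Bornology.IsBounded Ω) {p : ℝ≥0∞}
    (hp : 2 ≤ p) (u v w : LpOn Ω p) :
    innerL2 hb hp u (v + w) = innerL2 hb hp u v + innerL2 hb hp u w := by
  rw [innerL2, map_add, inner_add_right]; rfl

theorem coeFn_nemitskii {n : ℕ} {Ω : Set (E n)} (hΩ : IsOpen Ω) (hb : Bornology.IsBounded Ω)
    {f : E n → ℝ → ℝ} (hf : ContinuousOn (Function.uncurry f) (Ω ×ˢ univ))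
    (hm : ∃ m : ℝ, 0 < m ∧ ∀ x ∈ Ω, ∀ s, |f x s| ≤ m) {p : ℝ≥0∞} (u : LpOn Ω p) :
    nemitskii hΩ hb hf hm p u =ᵐ[volume.restrict Ω] fun x => f x (u x) :=
  MemLp.coeFn_toLp (memLp_nemitskii hΩ hb hf hm u)

theorem exists_norm_toL2_nemitskii_le {n : ℕ} {Ω : Set (E n)} (hΩ : IsOpen Ω)
    (hb : Bornology.IsBounded Ω) {f : E n → ℝ → ℝ}
    (hf : ContinuousOn (Function.uncurry f) (Ω ×ˢ univ))
    (hm : ∃ m : ℝ, 0 < m ∧ ∀ x ∈ Ω, ∀ s, |f x s| ≤ m) {p : ℝ≥0∞} (hp : 2 ≤ p) :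
    ∃ C : ℝ, ∀ u : LpOn Ω p, ‖toL2 hb hp (nemitskii hΩ hb hf hm p u)‖ ≤ C := by
  have := isFiniteMeasure_of_bounded hb
  obtain ⟨m, hm0, hm'⟩ := id hm
  refine ⟨_, fun u => Lp.norm_le_of_ae_bound (C := m) hm0.le ?_⟩
  filter_upwards [coeFn_toL2 hb hp (nemitskii hΩ hb hf hm p u), coeFn_nemitskii hΩ hb hf hm u,
    ae_restrict_mem hΩ.measurableSet] with x h1 h2 hx
  rw [h1, h2]
  exact hm' x hx _

/-- The Landesman–Lazer expression as a single integral. -/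
theorem landesmanLazer_eq {n : ℕ} {Ω : Set (E n)} (hΩ : IsOpen Ω) (hb : Bornology.IsBounded Ω)
    {p : ℝ≥0∞} [hp1 : Fact (1 ≤ p)] {fp fm : E n → ℝ} (hfp : ContinuousOn fp Ω)
    (hfm : ContinuousOn fm Ω) (hbp : ∃ C, ∀ x ∈ Ω, ‖fp x‖ ≤ C) (hbm : ∃ C, ∀ x ∈ Ω, ‖fm x‖ ≤ C)
    (u : LpOn Ω p) :
    landesmanLazer fp fm u = ∫ x in Ω, ({x | 0 < u x}.indicator (fun x => fp x * u x) x
      + {x | u x < 0}.indicator (fun x => fm x * u x) x) := by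
  have := isFiniteMeasure_of_bounded hb
  have hmeas := (Lp.stronglyMeasurable u).measurable
  have hs1 : MeasurableSet {x | 0 < u x} := measurableSet_lt measurable_const hmeas
  have hs2 : MeasurableSet {x | u x < 0} := measurableSet_lt hmeas measurable_const
  have i1 := (memLp_mul_of_bound hΩ
    (hfp.aestronglyMeasurable hΩ.measurableSet) hbp u).integrable hp1.out
  have i2 := (memLp_mul_of_bound hΩ
    (hfm.aestronglyMeasurable hΩ.measurableSet) hbm u).integrable hp1.out
  rw [integral_add (i1.indicator hs1) (i2.indicator hs2), integral_indicator hs1,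
    integral_indicator hs2, Measure.restrict_restrict hs1, Measure.restrict_restrict hs2,
    inter_comm, inter_comm {x | u x < 0}]
  rfl

/-- If `u_k = t_k w_k` with `t_k → ∞` and `w_k → v` almost everywhere, then `⟨F(u_k), v⟩` converges
to the Landesman–Lazer expression of `v`. -/
theorem tendsto_innerL2_nemitskii {n : ℕ} {Ω : Set (E n)} (hΩ : IsOpen Ω)
    (hb : Bornology.IsBounded Ω) {f : E n → ℝ → ℝ}
    (hf : ContinuousOn (Function.uncurry f) (Ω ×ˢ univ))
    (hm : ∃ m : ℝ, 0 < m ∧ ∀ x ∈ Ω, ∀ s, |f x s| ≤ m) {fp fm : E n → ℝ}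
    (hfp : ContinuousOn fp Ω) (hfm : ContinuousOn fm Ω)
    (hlimp : ∀ x ∈ Ω, Tendsto (f x) atTop (𝓝 (fp x)))
    (hlimm : ∀ x ∈ Ω, Tendsto (f x) atBot (𝓝 (fm x)))
    {p : ℝ≥0∞} [hp1 : Fact (1 ≤ p)] (hp : 2 ≤ p) {u : ℕ → LpOn Ω p} {v : LpOn Ω p} {t : ℕ → ℝ}
    (ht : Tendsto t atTop atTop)
    (hw : ∀ᵐ x ∂volume.restrict Ω, Tendsto (fun k => (t k)⁻¹ * u k x) atTop (𝓝 (v x))) :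
    Tendsto (fun k => innerL2 hb hp (nemitskii hΩ hb hf hm p (u k)) v) atTop
      (𝓝 (landesmanLazer fp fm v)) := by
  obtain ⟨m, hm0, hm'⟩ := id hm
  have hbp : ∀ x ∈ Ω, ‖fp x‖ ≤ m := fun x hx =>
    le_of_tendsto (hlimp x hx).norm (Eventually.of_forall fun s => hm' x hx s)
  have hbm : ∀ x ∈ Ω, ‖fm x‖ ≤ m := fun x hx =>
    le_of_tendsto (hlimm x hx).norm (Eventually.of_forall fun s => hm' x hx s)
  rw [landesmanLazer_eq hΩ hb hfp hfm ⟨m, hbp⟩ ⟨m, hbm⟩]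
  simp only [innerL2_eq]
  refine tendsto_integral_of_dominated_convergence (fun x => m * ‖v x‖)
    (fun k => (integrable_mul hb hp _ v).aestronglyMeasurable)
    ((LpOn.integrable hb v).norm.const_mul m) (fun k => ?_) ?_
  · filter_upwards [coeFn_nemitskii hΩ hb hf hm (u k), ae_restrict_mem hΩ.measurableSet]
      with x h1 hx
    rw [norm_mul, h1]
    exact mul_le_mul_of_nonneg_right (hm' x hx _) (norm_nonneg _)
  · filter_upwards [ae_all_iff.2 fun k => coeFn_nemitskii hΩ hb hf hm (u k),
      ae_restrict_mem hΩ.measurableSet, hw] with x h1 hx hwx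
    simp only [h1]
    have hu : (fun k => u k x) =ᶠ[atTop] fun k => t k * ((t k)⁻¹ * u k x) := by
      filter_upwards [ht.eventually_gt_atTop 0] with k hk
      rw [mul_inv_cancel_left₀ hk.ne']
    -- The sign of `v x` decides whether `u k x` tends to `-∞` or `+∞`. Where `v x = 0`, `f x (u k
    -- x)` need not converge, but the factor `v x` removes it.
    rcases lt_trichotomy (v x) 0 with hv | hv | hv
    · have h2 : Tendsto (fun k => u k x) atTop atBot :=
        (ht.atTop_mul_neg hv hwx).congr' hu.symm
      simpa [indicator, hv, hv.not_gt] using ((hlimm x hx).comp h2).mul_const (v x)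
    · simp [indicator, hv]
    · have h2 : Tendsto (fun k => u k x) atTop atTop :=
        (ht.atTop_mul_pos hv hwx).congr' hu.symm
      simpa [indicator, hv, hv.not_gt] using ((hlimp x hx).comp h2).mul_const (v x)

/-- Asymptotics of `⟨F(z + x), x + y⟩` as `‖x‖ → ∞` in a space of finite dimension, with `z` and
`y` bounded. -/
theorem exists_subseq_tendsto_landesmanLazer {n : ℕ} {Ω : Set (E n)} (hΩ : IsOpen Ω)
    (hb : Bornology.IsBounded Ω) {f : E n → ℝ → ℝ}
    (hf : ContinuousOn (Function.uncurry f) (Ω ×ˢ univ))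
    (hm : ∃ m : ℝ, 0 < m ∧ ∀ x ∈ Ω, ∀ s, |f x s| ≤ m) {fp fm : E n → ℝ}
    (hfp : ContinuousOn fp Ω) (hfm : ContinuousOn fm Ω)
    (hlimp : ∀ x ∈ Ω, Tendsto (f x) atTop (𝓝 (fp x)))
    (hlimm : ∀ x ∈ Ω, Tendsto (f x) atBot (𝓝 (fm x)))
    {p : ℝ≥0∞} [hp1 : Fact (1 ≤ p)] (hp : 2 ≤ p) {W : Submodule ℝ (LpOn Ω p)}
    [FiniteDimensional ℝ (W.map (toL2 hb hp))] {x y z : ℕ → LpOn Ω p} (hx : ∀ k, x k ∈ W)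
    (hxt : Tendsto (fun k => ‖toL2 hb hp (x k)‖) atTop atTop) {My Mz : ℝ}
    (hy : ∀ k, ‖toL2 hb hp (y k)‖ ≤ My) (hz : ∀ k, ‖toL2 hb hp (z k)‖ ≤ Mz) :
    ∃ v ∈ W, v ≠ 0 ∧ ∃ ψ : ℕ → ℕ, StrictMono ψ ∧
      Tendsto (fun k => ‖toL2 hb hp (x (ψ k))‖⁻¹ *
          innerL2 hb hp (nemitskii hΩ hb hf hm p (z (ψ k) + x (ψ k))) (x (ψ k) + y (ψ k)))
        atTop (𝓝 (landesmanLazer fp fm v)) := by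
  set T := toL2 hb hp
  set t : ℕ → ℝ := fun k => ‖T (x k)‖ with ht
  have hti : Tendsto (fun k => (t k)⁻¹) atTop (𝓝 0) := tendsto_inv_atTop_zero.comp hxt
  let s : ℕ → W.map T := fun k =>
    ⟨(t k)⁻¹ • T (x k), Submodule.smul_mem _ _ (Submodule.mem_map_of_mem (hx k))⟩
  -- The product is left unevaluated: it is `1`, or `0` when `t k = 0`, and so at most `1` in either
  -- case.
  have hsn : ∀ k, ‖s k‖ = (t k)⁻¹ * t k := fun k => by
    change ‖(t k)⁻¹ • T (x k)‖ = _
    rw [norm_smul, norm_inv, norm_norm]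
  -- Here finite dimension enters: the closed unit ball of `W.map T` is compact, so the limit is
  -- again `T v` with `v ∈ W`.
  obtain ⟨s', -, ψ₁, hψ₁, hs'⟩ := tendsto_subseq_of_bounded
    (Metric.isBounded_closedBall (x := (0 : W.map T)) (r := 1)) (x := s) fun k => by
      rw [mem_closedBall_zero_iff, hsn]
      exact inv_mul_le_one
  obtain ⟨v, hvW, hv⟩ := Submodule.mem_map.1 s'.2
  have hsT : Tendsto (fun k => (t (ψ₁ k))⁻¹ • T (x (ψ₁ k))) atTop (𝓝 (T v)) := by
    rw [hv]
    exact (continuous_subtype_val.tendsto s').comp hs'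
  have hn1 : ‖T v‖ = 1 := by
    refine tendsto_nhds_unique hsT.norm (tendsto_const_nhds.congr' ?_)
    filter_upwards [(hxt.comp hψ₁.tendsto_atTop).eventually_gt_atTop 0] with k hk
    have hk' : t (ψ₁ k) ≠ 0 := ne_of_gt hk
    exact ((hsn (ψ₁ k)).trans (inv_mul_cancel₀ hk')).symm
  -- Sequences bounded in `L²` disappear after division by `t k`; this applies to both `z` and `y`.
  have hsmall : ∀ {g : ℕ → LpOn Ω p} {M : ℝ}, (∀ k, ‖T (g k)‖ ≤ M) →
      Tendsto (fun k => (t (ψ₁ k))⁻¹ • T (g (ψ₁ k))) atTop (𝓝 0) := fun {g M} hg => by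
    have h0 : Tendsto (fun k => (t (ψ₁ k))⁻¹ * M) atTop (𝓝 0) := by
      simpa using (hti.comp hψ₁.tendsto_atTop).mul_const M
    refine squeeze_zero_norm (fun k => ?_) h0
    rw [norm_smul, norm_inv, norm_norm]
    exact mul_le_mul_of_nonneg_left (hg _) (inv_nonneg.2 (norm_nonneg _))
  have hw : Tendsto (fun k => (t (ψ₁ k))⁻¹ • T (z (ψ₁ k) + x (ψ₁ k))) atTop (𝓝 (T v)) := by
    simpa [smul_add] using (hsmall hz).add hsT
  have hr : Tendsto (fun k => (t (ψ₁ k))⁻¹ • T (x (ψ₁ k) + y (ψ₁ k))) atTop (𝓝 (T v)) := by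
    simpa [smul_add] using hsT.add (hsmall hy)
  -- Convergence in `L²` gives convergence in measure, hence almost everywhere along a further
  -- subsequence.
  obtain ⟨ψ₂, hψ₂, hae⟩ := (tendstoInMeasure_of_tendsto_Lp hw).exists_seq_tendsto_ae
  refine ⟨v, hvW, fun h => by simp [h] at hn1, ψ₁ ∘ ψ₂, hψ₁.comp hψ₂, ?_⟩
  have hae' : ∀ᵐ a ∂volume.restrict Ω, Tendsto (fun k => (t (ψ₁ (ψ₂ k)))⁻¹ *
      (z (ψ₁ (ψ₂ k)) + x (ψ₁ (ψ₂ k)) : LpOn Ω p) a) atTop (𝓝 (v a)) := by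
    filter_upwards [hae, coeFn_toL2 hb hp v,
      ae_all_iff.2 fun k => coeFn_toL2 hb hp (z k + x k),
      ae_all_iff.2 fun k => Lp.coeFn_smul (t k)⁻¹ (T (z k + x k))] with a h1 h2 h3 h4
    rw [← h2]
    refine h1.congr fun k => ?_
    rw [h4, Pi.smul_apply, h3, smul_eq_mul]
  have hlim := tendsto_innerL2_nemitskii hΩ hb hf hm hfp hfm hlimp hlimm hp
    (hxt.comp (hψ₁.comp hψ₂).tendsto_atTop) hae'
  obtain ⟨C, hC⟩ := exists_norm_toL2_nemitskii_le hΩ hb hf hm hp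
  -- The scaled second argument may be replaced by `T v`: `F` is bounded in `L²`, so Cauchy–Schwarz
  -- applies.
  have hdiff : Tendsto (fun k => inner ℝ
      (T (nemitskii hΩ hb hf hm p (z (ψ₁ (ψ₂ k)) + x (ψ₁ (ψ₂ k)))))
      ((t (ψ₁ (ψ₂ k)))⁻¹ • T (x (ψ₁ (ψ₂ k)) + y (ψ₁ (ψ₂ k))) - T v)) atTop (𝓝 0) := by
    have h0 : Tendsto (fun k => C * ‖(t (ψ₁ (ψ₂ k)))⁻¹ • T (x (ψ₁ (ψ₂ k)) + y (ψ₁ (ψ₂ k))) - T v‖)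
        atTop (𝓝 0) := by
      simpa using ((hr.comp hψ₂.tendsto_atTop).sub_const (T v)).norm.const_mul C
    refine squeeze_zero_norm (fun k => ?_) h0
    exact (norm_inner_le_norm _ _).trans (mul_le_mul_of_nonneg_right (hC _) (norm_nonneg _))
  have := hdiff.add hlim
  rw [zero_add] at this
  refine this.congr fun k => ?_
  simp only [innerL2, inner_sub_right, real_inner_smul_right, Function.comp_apply]
  exact sub_add_cancel _ _

end LL

/-! ### The contradiction argument -/

theorem mainTheorem2 (n : ℕ) (hn : 1 ≤ n)
    (Ω : Set (EuclideanSpace ℝ (Fin n))) (hΩ : IsOpen Ω) (hb : Bornology.IsBounded Ω)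
    (hC1 : LL.HasC1Boundary Ω)
    (a : Fin n → Fin n → EuclideanSpace ℝ (Fin n) → ℝ) (ha : LL.IsEllipticCoeff Ω a)
    (p : ℝ≥0∞) [Fact (1 ≤ p)] (hp : 2 ≤ p) (hp' : p ≠ ⊤)
    (α : ℝ) (hα : α ∈ Ioo (0 : ℝ) 1) (lam : ℝ)
    (f : EuclideanSpace ℝ (Fin n) → ℝ → ℝ)
    (hf : ContinuousOn (Function.uncurry f) (Ω ×ˢ univ))
    (hE1 : ∃ L : ℝ, 0 < L ∧ ∀ x ∈ Ω, ∀ s₁ s₂ : ℝ, |f x s₁ - f x s₂| ≤ L * |s₁ - s₂|)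
    (hE2 : ∃ m : ℝ, 0 < m ∧ ∀ x ∈ Ω, ∀ s : ℝ, |f x s| ≤ m)
    (fp fm : EuclideanSpace ℝ (Fin n) → ℝ)
    (hfp : ContinuousOn fp Ω) (hfm : ContinuousOn fm Ω)
    (hlimp : ∀ x ∈ Ω, Tendsto (f x) atTop (𝓝 (fp x)))
    (hlimm : ∀ x ∈ Ω, Tendsto (f x) atBot (𝓝 (fm x))) :
    ((∀ u ∈ LL.eigenspace (LL.ellipticOp hΩ hb ha p) lam, u ≠ 0 → 0 < LL.landesmanLazer fp fm u) →
      ∀ B₁ B₂ : Set (LL.LpOn Ω p),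
        B₁ ⊆ LL.alphaSpace hb hp (LL.ellipticOp hΩ hb ha p) α lam →
        B₂ ⊆ LL.eigenspace (LL.ellipticOp hΩ hb ha p) lam →
        (∃ M : ℝ, ∀ z ∈ B₁, LL.fracNorm (LL.ellipticOp hΩ hb ha p) α z ≤ M) →
        (∃ M : ℝ, ∀ y ∈ B₂, ‖LL.toL2 hb hp y‖ ≤ M) →
        ∃ R ρ : ℝ, 0 < R ∧ 0 < ρ ∧
          ∀ z ∈ B₁, ∀ y ∈ B₂, ∀ x ∈ LL.eigenspace (LL.ellipticOp hΩ hb ha p) lam,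
            R ≤ ‖LL.toL2 hb hp x‖ →
            LL.innerL2 hb hp (LL.nemitskii hΩ hb hf hE2 p (z + x)) x
              > - LL.innerL2 hb hp (LL.nemitskii hΩ hb hf hE2 p (z + x)) y + ρ) ∧
    ((∀ u ∈ LL.eigenspace (LL.ellipticOp hΩ hb ha p) lam, u ≠ 0 → LL.landesmanLazer fp fm u < 0) →
      ∀ B₁ B₂ : Set (LL.LpOn Ω p),
        B₁ ⊆ LL.alphaSpace hb hp (LL.ellipticOp hΩ hb ha p) α lam →
        B₂ ⊆ LL.eigenspace (LL.ellipticOp hΩ hb ha p) lam →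
        (∃ M : ℝ, ∀ z ∈ B₁, LL.fracNorm (LL.ellipticOp hΩ hb ha p) α z ≤ M) →
        (∃ M : ℝ, ∀ y ∈ B₂, ‖LL.toL2 hb hp y‖ ≤ M) →
        ∃ R ρ : ℝ, 0 < R ∧ 0 < ρ ∧
          ∀ z ∈ B₁, ∀ y ∈ B₂, ∀ x ∈ LL.eigenspace (LL.ellipticOp hΩ hb ha p) lam,
            R ≤ ‖LL.toL2 hb hp x‖ →
            LL.innerL2 hb hp (LL.nemitskii hΩ hb hf hE2 p (z + x)) x
              < - LL.innerL2 hb hp (LL.nemitskii hΩ hb hf hE2 p (z + x)) y - ρ) := by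
  have := LL.finiteDimensional_map_eigenspace hΩ hb ha hp lam
  obtain ⟨C, hC0, hC⟩ := LL.exists_norm_toL2_le hb hp
  have hbound : ∀ B₁ : Set (LL.LpOn Ω p),
      B₁ ⊆ LL.alphaSpace hb hp (LL.ellipticOp hΩ hb ha p) α lam →
      (∃ M : ℝ, ∀ z ∈ B₁, LL.fracNorm (LL.ellipticOp hΩ hb ha p) α z ≤ M) →
      ∃ M : ℝ, ∀ z ∈ B₁, ‖LL.toL2 hb hp z‖ ≤ M := fun B₁ h1 h2 => by
    obtain ⟨M, hM⟩ := LL.exists_norm_le_of_fracNorm_le _ α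
      (h1.trans (LL.alphaSpace_le_fracSpace hb hp _ α lam)) h2
    exact ⟨C * M, fun z hz => (hC z).trans (mul_le_mul_of_nonneg_left (hM z hz) hC0)⟩
  -- Since `t k ≥ 1`, dividing the bound `1/(k+1)` by `t k` does not increase it.
  have hdecay : ∀ {t : ℕ → ℝ}, (∀ k : ℕ, (k : ℝ) + 1 ≤ t k) →
      ∀ k, 0 ≤ (t k)⁻¹ ∧ (t k)⁻¹ * (1 / ((k : ℝ) + 1)) ≤ 1 / ((k : ℝ) + 1) := fun {t} ht k => by
    have h1 : 1 ≤ t k := le_trans (by linarith [(Nat.cast_nonneg k : (0 : ℝ) ≤ k)]) (ht k)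
    exact ⟨by positivity, mul_le_of_le_one_left (by positivity) (inv_le_one_of_one_le₀ h1)⟩
  have htop : ∀ {t : ℕ → ℝ}, (∀ k : ℕ, (k : ℝ) + 1 ≤ t k) → Tendsto t atTop atTop :=
    fun {t} ht => tendsto_atTop_mono (fun k => (by linarith [ht k] : (k : ℝ) ≤ t k))
      tendsto_natCast_atTop_atTop
  constructor
  · intro hLL B₁ B₂ hB₁ hB₂ hM₁ hM₂
    obtain ⟨M₁, hM₁⟩ := hbound B₁ hB₁ hM₁
    obtain ⟨M₂, hM₂⟩ := hM₂
    by_contra! hcon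
    -- Failure for `R = k + 1` and `ρ = 1/(k+1)` gives `‖x k‖₂ → ∞` together with `⟨F, x k + y k⟩ ≤
    -- 1/(k+1)`, so the limit is `≤ 0`.
    have hseq := fun k : ℕ => hcon (k + 1) (1 / (k + 1)) (by positivity) (by positivity)
    choose z hz y hy x hx hxn hle using hseq
    obtain ⟨v, hv, hv0, ψ, hψ, hlim⟩ := LL.exists_subseq_tendsto_landesmanLazer hΩ hb hf hE2 hfp
      hfm hlimp hlimm hp hx (htop hxn) (fun k => hM₂ _ (hy k)) (fun k => hM₁ _ (hz k))
    refine (hLL v hv hv0).not_ge (le_of_tendsto_of_tendsto hlim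
      (tendsto_one_div_add_atTop_nhds_zero_nat.comp hψ.tendsto_atTop)
      (Eventually.of_forall fun k => ?_))
    obtain ⟨h1, h2⟩ := hdecay hxn (ψ k)
    refine le_trans (mul_le_mul_of_nonneg_left ?_ h1) h2
    rw [LL.innerL2_add_right]
    linarith [hle (ψ k)]
  · intro hLL B₁ B₂ hB₁ hB₂ hM₁ hM₂
    obtain ⟨M₁, hM₁⟩ := hbound B₁ hB₁ hM₁
    obtain ⟨M₂, hM₂⟩ := hM₂
    by_contra! hcon
    -- Mirror image of (i): failure now gives the lower bound `-1/(k+1)`, so the limit is `≥ 0`.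
    have hseq := fun k : ℕ => hcon (k + 1) (1 / (k + 1)) (by positivity) (by positivity)
    choose z hz y hy x hx hxn hle using hseq
    obtain ⟨v, hv, hv0, ψ, hψ, hlim⟩ := LL.exists_subseq_tendsto_landesmanLazer hΩ hb hf hE2 hfp
      hfm hlimp hlimm hp hx (htop hxn) (fun k => hM₂ _ (hy k)) (fun k => hM₁ _ (hz k))
    have hneg := (tendsto_one_div_add_atTop_nhds_zero_nat (𝕜 := ℝ)).comp hψ.tendsto_atTop |>.neg
    rw [neg_zero] at hneg
    refine (hLL v hv hv0).not_ge (le_of_tendsto_of_tendsto hneg hlim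
      (Eventually.of_forall fun k => ?_))
    obtain ⟨h1, h2⟩ := hdecay hxn (ψ k)
    refine (neg_le_neg h2).trans ?_
    rw [← mul_neg]
    refine mul_le_mul_of_nonneg_left ?_ h1
    rw [LL.innerL2_add_right]
    linarith [hle (ψ k)]
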